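/- **Setting.** Let $m_a,m_b,m_s,\mathcal I_b,L,d_G,g,T_{max}>0$, and put $M_t=m_s+m_b+m_a$, $M_a=\frac{m_bd_G}{L}+m_a$, $\mathcal I_0=\frac{m_bd_G^2+\mathcal I_b}{L}+m_aL$. For $q=(x,\alpha)$ let $$M(q)=\begin{pmatrix}M_t&-M_aL\sin\alpha\\-M_aL\sin\alpha&\mathcal I_0L\end{pmatrix},\quad C(q,\dot q)=\begin{pmatrix}0&-M_aL\dot\alpha\cos\alpha\\0&0\end{pmatrix},\quad g(q)=\begin{pmatrix}0\\M_aLg\cos\alpha\end{pmatrix}.$$ Let $k_{p,x}>k_{p,\alpha}>0$, $k_{v,x}>k_{v,\alpha}>0$, $\epsilon>0$, $\gamma=\frac{\pi}{2\arctan(\epsilon T_{max}L)}$, and $\sigma_\lambda(y)=\mathrm{sign}(y)\min(|y|,\lambda)$. For a desired configuration $q_d=(x_d,\alpha_d)$ put $\tilde q=q_d-q=(\tilde x,\tilde\alpha)$ and $$f_t=k_{p,\alpha}\tilde\alpha-k_{v,\alpha}\dot\alpha+M_aLg\cos\alpha,\quad \theta_d=\sigma_{\pi/2}(\gamma\arctan(\epsilon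 f_t)),\quad u_n=\frac{f_t}{\sin\theta_d},\quad \beta_d=\theta_d+\alpha,$$ with $u_n=\frac1{\gamma\epsilon}$ (the limit) when $f_t=0$. Let $\beta$ be the actual attitude of the UAV and $\tilde\beta=\beta-\beta_d$ the attitude error, regarded as an exogenous input. The closed loop is $$M(q)\ddot q+C(q,\dot q)\dot q+g(q)=\tau,\qquad \tau=K_p(\tilde\beta)\tilde q-K_v(\tilde\beta)\dot q+g(q)+\delta_{\tilde\beta},$$ where $K_p(\tilde\beta)=\mathrm{diag}(k_{p,x},k_{p,\alpha}\cos\tilde\beta)$, $K_v(\tilde\beta)=\mathrm{diag}(k_{v,x},k_{v,\alpha}\cos\tilde\beta)$, $\delta_{\tilde\beta}=\bigl(0,\;u_n\cos\theta_d\sin\tilde\beta-2M_aLg\cos\alpha\sin^2(\tilde\beta/2)\bigr)$; equivalently $\tau=(k_{p,x}\tilde x-k_{v,x}\dot x,\;u_n\sin(\beta-\alpha))$. Solutions are understood with $q,\dot q$ continuous and right derivatives, so that the input may jump. Let $\alpha_{min}=\arccos\frac{T_{max}}{M_ag}$ and $\alpha_{max}=\arccos\frac{-T_{max}}{M_ag}$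 if $T_{max}<M_ag$, and $\alpha_{min}=0$, $\alpha_{max}=\pi$ otherwise. Norms are Euclidean. **Constants.** Let $\lambda_M$ be the largest eigenvalue of $M(q)$ over all $q$. Call $(\xi,k_c,\gamma_p,\mu,\tilde q_{max,1},\tilde q_{max,2})$ admissible if $0<\xi<\pi/2$; $k_c>0$ and $\|C(q,\dot q)\dot q\|\le k_c\|\dot q\|^2$ for all $q,\dot q$; and, with $\lambda_m=k_{v,\alpha}\sin\xi$ and $P=\frac12\lambda_m-2\gamma_p\lambda_M-\gamma_pk_c$, $$0<\gamma_p<\min\Bigl\{\sqrt{\tfrac{k_{p,\alpha}}{\lambda_M}},\tfrac{2k_{p,\alpha}\sin\xi}{k_{v,x}},\tfrac{\lambda_m}{2(k_c+2\lambda_M)}\Bigr\},\quad 0<\mu<\min\Bigl\{P,\;\gamma_pk_{p,x}-\tfrac{\gamma_p^2k_{v,x}}2,\;\gamma_pk_{p,\alpha}-\tfrac{\gamma_p^2k_{v,\alpha}}2\Bigr\},$$ $$0<\tilde q_{max,1}<\frac{2\gamma_pk_{p,x}}{2\mu+\gamma_p^2k_{v,x}}-1,\qquad 0<\tilde q_{max,2}<\frac{2\gamma_pk_{p,\alpha}}{2\mu+\gamma_p^2k_{v,\alpha}}-1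 .$$ Put $\tilde q_{max}=\min\{\tilde q_{max,1},\tilde q_{max,2}\}$ and $\tilde\theta_{max}=\min\{\tilde\theta_{max,1},\tilde\theta_{max,2},\frac\pi2-\xi\}$, where $$\tilde\theta_{max,1}=\arccos\frac{k_{p,\alpha}+\mu}{\frac{\gamma_pk_{p,\alpha}}{1+\tilde q_{max,2}}-\frac{\gamma_p^2k_{v,\alpha}}2+k_{p,\alpha}},\qquad \tilde\theta_{max,2}=\arccos\max\Bigl\{-1,\frac{\mu+k_{p,\alpha}-P}{k_{p,\alpha}}\Bigr\}.$$ **Lemma.** Admissible constants exist. For every admissible choice, $\tilde q_{max}>0$, $\tilde\theta_{max}>0$, and: 1. For all $x_d\in\mathbb R$ and $\alpha_d\in(\alpha_{min},\alpha_{max})$ the closed loop is ISS with respect to $\tilde\beta$ with restrictions $|\tilde\beta|<\tilde\theta_{max}$ and $\|\tilde q\|<\tilde q_{max}$. That is: (a) for every initial state and every continuous input with $|\tilde\beta(t)|<\tilde\theta_{max}$ for all $t\ge0$ there is a solution on $[0,\infty)$; (b) there are a class $\mathcal{KL}$ function $b$ and a class $\mathcal K$ function $\kappa$ such that every solution on an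 interval $[0,T)$ on which $|\tilde\beta|<\tilde\theta_{max}$ and $\|\tilde q\|<\tilde q_{max}$ satisfies, for all $t\in[0,T)$, $$\|(\tilde q(t),\dot q(t))\|\le b\bigl(\|(\tilde q(0),\dot q(0))\|,t\bigr)+\kappa\Bigl(\sup_{0\le s\le t}|\tilde\beta(s)|\Bigr);$$ (c) there are $r,d>0$ such that $\|(\tilde q(0),\dot q(0))\|<r$ and $|\tilde\beta|<d$ imply $\|\tilde q\|<\tilde q_{max}$ as long as the solution is defined. 2. The asymptotic gain from $\tilde\beta$ to $\dot\beta_d$ exists and is finite: there is $\gamma_{out}\ge0$, independent of $x_d$ and $\alpha_d$, such that for all $x_d\in\mathbb R$, $\alpha_d\in(\alpha_{min},\alpha_{max})$ and every solution on $[0,\infty)$ with $|\tilde\beta|<\tilde\theta_{max}$ and $\|\tilde q\|<\tilde q_{max}$ for all times, $\beta_d$ has a right derivative $\dot\beta_d(t)$ at every $t\ge0$, and $$\limsup_{t\to\infty}|\dot\beta_d(t)|\le\gamma_{out}\limsup_{t\to\infty}|\tilde\beta(t)| .$$ -/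

import Mathlib

open Filter Topology Matrix

noncomputable section

namespace AerialManip

/-- Physical parameters of the planar UAV / UGV / object system, the maximal thrust, and the gains
of the outer-loop control law. -/
structure Params where
  /-- masses of the UAV, of the object and of the UGV -/
  ma : ℝ
  mb : ℝ
  ms : ℝ
  /-- moment of inertia of the object, its length, distance of its centre of mass from the UGV -/
  Ib : ℝ
  L : ℝ
  dG : ℝ
  /-- gravity acceleration -/
  g : ℝ
  /-- maximal thrust -/
  Tmax : ℝ
  /-- control gains -/
  kpx : ℝ
  kvx : ℝ
  kpa : ℝ
  kva : ℝ
  /-- tuning parameter of the map from the tangential force to the desired relative attitude -/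
  eps : ℝ
  ma_pos : 0 < ma
  mb_pos : 0 < mb
  ms_pos : 0 < ms
  Ib_pos : 0 < Ib
  L_pos : 0 < L
  dG_pos : 0 < dG
  g_pos : 0 < g
  Tmax_pos : 0 < Tmax
  kpa_pos : 0 < kpa
  kva_pos : 0 < kva
  kpa_lt : kpa < kpx
  kva_lt : kva < kvx
  eps_pos : 0 < eps

namespace Params

variable (p : Params)

/-- total mass -/
def Mt : ℝ := p.ms + p.mb + p.ma

/-- apparent mass of the UAV and the object -/
def Ma : ℝ := p.mb * p.dG / p.L + p.ma

/-- moment of inertia divided by the length -/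
def I0 : ℝ := (p.mb * p.dG ^ 2 + p.Ib) / p.L + p.ma * p.L

/-- Inertia matrix at `q = (x, α)`. -/
def M (q : Fin 2 → ℝ) : Matrix (Fin 2) (Fin 2) ℝ :=
  !![p.Mt, -(p.Ma * p.L * Real.sin (q 1)); -(p.Ma * p.L * Real.sin (q 1)), p.I0 * p.L]

/-- Coriolis matrix at position `q` and velocity `v`. -/
def C (q v : Fin 2 → ℝ) : Matrix (Fin 2) (Fin 2) ℝ :=
  !![0, -(p.Ma * p.L * v 1 * Real.cos (q 1)); 0, 0]

/-- Gravity vector. -/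
def grav (q : Fin 2 → ℝ) : Fin 2 → ℝ := ![0, p.Ma * p.L * p.g * Real.cos (q 1)]

/-- Smallest and largest attainable steady-state inclination. When `Tmax ≥ Ma g` these are `0` and
`π`, since `Real.arccos` is `0` on `[1, ∞)` and `π` on `(-∞, -1]`. -/
def alphaMin : ℝ := Real.arccos (p.Tmax / (p.Ma * p.g))

def alphaMax : ℝ := Real.arccos (-p.Tmax / (p.Ma * p.g))

/-- The gain `γ` of the attitude map. -/
def gam : ℝ := Real.pi / (2 * Real.arctan (p.eps * p.Tmax * p.L))

end Params

/-- The saturation `σ_l(y) = sign(y) min(|y|, l)`. -/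
def sat (l y : ℝ) : ℝ := Real.sign y * min |y| l

/-- Euclidean norm on `ℝ²`. -/
def nrm (v : Fin 2 → ℝ) : ℝ := ‖(WithLp.toLp 2 v : EuclideanSpace ℝ (Fin 2))‖

/-- Euclidean norm on `ℝ⁴` of the stacked vector `(e, v)`. -/
def nrmPair (e v : Fin 2 → ℝ) : ℝ := Real.sqrt (nrm e ^ 2 + nrm v ^ 2)

namespace Params

variable (p : Params)

/-- Desired tangential force: PD with gravity compensation; `qd = (x_d, α_d)`. -/
def ft (qd q v : Fin 2 → ℝ) : ℝ :=
  p.kpa * (qd 1 - q 1) - p.kva * v 1 + p.Ma * p.L * p.g * Real.cos (q 1)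

/-- Desired relative attitude `θ_d` as a function of the tangential force. -/
def thetaD (f : ℝ) : ℝ := sat (Real.pi / 2) (p.gam * Real.arctan (p.eps * f))

/-- Normalized thrust `u_n = f_t / sin θ_d`, extended by continuity at `f_t = 0`. -/
def un (f : ℝ) : ℝ := if f = 0 then 1 / (p.gam * p.eps) else f / Real.sin (p.thetaD f)

/-- Desired UAV attitude `β_d = θ_d + α`. -/
def betaD (qd q v : Fin 2 → ℝ) : ℝ := p.thetaD (p.ft qd q v) + q 1

def Kp (w : ℝ) : Matrix (Fin 2) (Fin 2) ℝ := !![p.kpx, 0; 0, p.kpa * Real.cos w]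

def Kv (w : ℝ) : Matrix (Fin 2) (Fin 2) ℝ := !![p.kvx, 0; 0, p.kva * Real.cos w]

/-- The exogenous term `δ`; its second entry is
`f_t (cos θ_d / sin θ_d) sin w - 2 g₂(q) sin² (w / 2)`, with `f_t / sin θ_d` read as `un`. -/
def delta (qd q v : Fin 2 → ℝ) (w : ℝ) : Fin 2 → ℝ :=
  ![0, p.un (p.ft qd q v) * Real.cos (p.thetaD (p.ft qd q v)) * Real.sin w
    - 2 * p.grav q 1 * Real.sin (w / 2) ^ 2]

/-- The control law in the presence of the attitude error `w`. -/
def tau (qd q v : Fin 2 → ℝ) (w : ℝ) : Fin 2 → ℝ :=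
  p.Kp w *ᵥ (qd - q) - p.Kv w *ᵥ v + p.grav q + p.delta qd q v w

theorem un_mul_sin (f : ℝ) : p.un f * Real.sin (p.thetaD f) = f := by
  unfold un
  split_ifs with h
  · subst h
    simp [thetaD, sat]
  · have h0 : 0 < p.eps * p.Tmax * p.L := mul_pos (mul_pos p.eps_pos p.Tmax_pos) p.L_pos
    have hg : 0 < p.gam := by
      unfold gam
      exact div_pos Real.pi_pos (mul_pos two_pos (Real.arctan_pos.2 h0))
    have hy : p.gam * Real.arctan (p.eps * f) ≠ 0 := by
      refine mul_ne_zero hg.ne' ?_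
      rw [Ne, Real.arctan_eq_zero_iff]
      exact mul_ne_zero p.eps_pos.ne' h
    have hs : Real.sin (p.thetaD f) ≠ 0 := by
      unfold thetaD sat
      generalize p.gam * Real.arctan (p.eps * f) = y at hy
      have hm : 0 < min |y| (Real.pi / 2) := lt_min (abs_pos.2 hy) (by positivity)
      have hlt : min |y| (Real.pi / 2) < Real.pi :=
        lt_of_le_of_lt (min_le_right _ _) (by linarith [Real.pi_pos])
      have hpos := Real.sin_pos_of_pos_of_lt_pi hm hlt
      rcases lt_or_gt_of_ne hy with hn | hp
      · rw [Real.sign_of_neg hn, neg_one_mul, Real.sin_neg]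
        exact neg_ne_zero.2 hpos.ne'
      · rw [Real.sign_of_pos hp, one_mul]
        exact hpos.ne'
    exact div_mul_cancel₀ f hs

/-- `tau` is the physical force vector `(u_ff, u_n sin θ)` for the actual relative attitude
`θ = θ_d + w`, that is, for the actual attitude `β = β_d + w`. -/
theorem tau_eq (qd q v : Fin 2 → ℝ) (w : ℝ) :
    p.tau qd q v w = ![p.kpx * (qd 0 - q 0) - p.kvx * v 0,
      p.un (p.ft qd q v) * Real.sin (p.thetaD (p.ft qd q v) + w)] := by
  have h := p.un_mul_sin (p.ft qd q v)
  have hw : Real.sin (w / 2) ^ 2 = (1 - Real.cos w) / 2 := by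
    rw [Real.sin_sq_eq_half_sub]
    ring_nf
  ext i
  fin_cases i
  · simp [tau, Kp, Kv, grav, delta, dotProduct, Fin.sum_univ_two]
  · simp only [tau, Kp, Kv, grav, delta, hw, Real.sin_add]
    have h2 : p.un (p.ft qd q v) * Real.sin (p.thetaD (p.ft qd q v)) * Real.cos w
        = p.ft qd q v * Real.cos w := by rw [h]
    have e : ∀ u : Fin 2 → ℝ, vecHead (vecTail u) = u 1 := fun _ => rfl
    simp only [ft] at h2 ⊢
    simp [e]
    linear_combination -h2

/-- `(q, v)` is a trajectory (position, velocity) of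
`M(q) q'' + C(q, q') q' + g(q) = τ` on the time set `I` under the attitude error `w`. Derivatives
are right derivatives of continuous functions, so that inputs may jump. -/
def IsTraj (qd : Fin 2 → ℝ) (I : Set ℝ) (w : ℝ → ℝ) (q v : ℝ → Fin 2 → ℝ) : Prop :=
  ContinuousOn q I ∧ ContinuousOn v I ∧ ∀ t ∈ I,
    HasDerivWithinAt q (v t) (Set.Ici t) t ∧
    ∃ a : Fin 2 → ℝ, HasDerivWithinAt v a (Set.Ici t) t ∧
      p.M (q t) *ᵥ a + p.C (q t) (v t) *ᵥ v t + p.grav (q t) = p.tau qd (q t) (v t) (w t)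

end Params

/-- Class `K` functions on `[0, ∞)`. -/
def IsClassK (k : ℝ → ℝ) : Prop :=
  k 0 = 0 ∧ ContinuousOn k (Set.Ici 0) ∧ StrictMonoOn k (Set.Ici 0)

/-- Class `KL` functions on `[0, ∞) × [0, ∞)`. -/
def IsClassKL (b : ℝ → ℝ → ℝ) : Prop :=
  ContinuousOn (Function.uncurry b) (Set.Ici 0 ×ˢ Set.Ici 0) ∧
  (∀ t, 0 ≤ t → IsClassK fun r => b r t) ∧
  ∀ r, 0 ≤ r → AntitoneOn (b r) (Set.Ici 0) ∧ Tendsto (b r) atTop (𝓝 0)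

/-- The closed loop with desired configuration `qd` is input-to-state stable with respect to the
attitude error `w`, with the restrictions `|w| < W` and `‖qd - q‖ < Q` on the signals:
solutions exist for all times; the ISS estimate holds as long as the restrictions do; and the
restriction on `qd - q` holds forever if initial state and input are small. -/
def ISSWithRestriction (p : Params) (qd : Fin 2 → ℝ) (W Q : ℝ) : Prop :=
  (∀ (q0 v0 : Fin 2 → ℝ) (w : ℝ → ℝ), ContinuousOn w (Set.Ici 0) → (∀ t, 0 ≤ t → |w t| < W) →
    ∃ q v : ℝ → Fin 2 → ℝ, p.IsTraj qd (Set.Ici 0) w q v ∧ q 0 = q0 ∧ v 0 = v0) ∧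
  (∃ (b : ℝ → ℝ → ℝ) (k : ℝ → ℝ), IsClassKL b ∧ IsClassK k ∧
    ∀ (T : ℝ) (w : ℝ → ℝ) (q v : ℝ → Fin 2 → ℝ), p.IsTraj qd (Set.Ico 0 T) w q v →
      (∀ t ∈ Set.Ico 0 T, |w t| < W ∧ nrm (qd - q t) < Q) →
      ∀ t ∈ Set.Ico 0 T, nrmPair (qd - q t) (v t) ≤
        b (nrmPair (qd - q 0) (v 0)) t + k (sSup ((fun s => |w s|) '' Set.Icc 0 t))) ∧
  ∃ r > 0, ∃ d > 0, ∀ (T : ℝ) (w : ℝ → ℝ) (q v : ℝ → Fin 2 → ℝ),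
    p.IsTraj qd (Set.Ico 0 T) w q v → nrmPair (qd - q 0) (v 0) < r →
    (∀ t ∈ Set.Ico 0 T, |w t| < d) → ∀ t ∈ Set.Ico 0 T, nrm (qd - q t) < Q

/-- Under the restrictions `|w| < W` and `‖qd - q‖ < Q`, the output `β_d'` (right derivative of the
desired attitude) is well defined along every trajectory on `[0, ∞)`, and
`limsup |β_d'| ≤ G * limsup |w|` as time tends to infinity. -/
def HasAsymptoticGain (p : Params) (qd : Fin 2 → ℝ) (W Q G : ℝ) : Prop :=
  ∀ (w : ℝ → ℝ) (q v : ℝ → Fin 2 → ℝ), p.IsTraj qd (Set.Ici 0) w q v →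
    (∀ t, 0 ≤ t → |w t| < W ∧ nrm (qd - q t) < Q) →
    (∀ t, 0 ≤ t →
      DifferentiableWithinAt ℝ (fun s => p.betaD qd (q s) (v s)) (Set.Ici t) t) ∧
    ∀ c : ℝ, (∀ᶠ t in atTop, |w t| ≤ c) → ∀ c' > G * c,
      ∀ᶠ t in atTop,
        |derivWithin (fun s => p.betaD qd (q s) (v s)) (Set.Ici t) t| ≤ c'

/-- Auxiliary constants that enter the explicit restrictions. -/
structure Consts where
  xi : ℝ
  kc : ℝ
  gp : ℝ
  mu : ℝ
  q1 : ℝ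
  q2 : ℝ

/-- The largest eigenvalue of the inertia matrix over all configurations. -/
def lamMaxM (p : Params) : ℝ := sSup (⋃ q : Fin 2 → ℝ, spectrum ℝ (p.M q))

/-- The smallest eigenvalue of `Kv w` over `|w| ≤ π / 2 - ξ`. -/
def lamMinKv (p : Params) (c : Consts) : ℝ := p.kva * Real.sin c.xi

/-- `½ λ_m{K_v} - 2 γ_p λ_M{M} - γ_p k_c`. -/
def dampMargin (p : Params) (c : Consts) : ℝ :=
  lamMinKv p c / 2 - 2 * c.gp * lamMaxM p - c.gp * c.kc

/-- The admissible choices of the auxiliary constants. -/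
structure Admissible (p : Params) (c : Consts) : Prop where
  xi_pos : 0 < c.xi
  xi_lt : c.xi < Real.pi / 2
  kc_pos : 0 < c.kc
  kc_bound : ∀ q v : Fin 2 → ℝ, nrm (p.C q v *ᵥ v) ≤ c.kc * nrm v ^ 2
  gp_pos : 0 < c.gp
  gp_lt : c.gp < min (min (Real.sqrt (p.kpa / lamMaxM p)) (2 * (p.kpa * Real.sin c.xi) / p.kvx))
    (lamMinKv p c / (2 * (c.kc + 2 * lamMaxM p)))
  mu_pos : 0 < c.mu
  mu_lt : c.mu < min (min (dampMargin p c) (c.gp * p.kpx - c.gp ^ 2 * p.kvx / 2))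
    (c.gp * p.kpa - c.gp ^ 2 * p.kva / 2)
  q1_pos : 0 < c.q1
  q1_lt : c.q1 < 2 * c.gp * p.kpx / (2 * c.mu + c.gp ^ 2 * p.kvx) - 1
  q2_pos : 0 < c.q2
  q2_lt : c.q2 < 2 * c.gp * p.kpa / (2 * c.mu + c.gp ^ 2 * p.kva) - 1

/-- The bound on `‖qd - q‖`. -/
def qMax (c : Consts) : ℝ := min c.q1 c.q2

def thetaMax1 (p : Params) (c : Consts) : ℝ :=
  |Real.arccos ((p.kpa + c.mu) /
    (c.gp * p.kpa / (1 + c.q2) - c.gp ^ 2 * p.kva / 2 + p.kpa))|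

def thetaMax2 (p : Params) (c : Consts) : ℝ :=
  |Real.arccos (-dampMargin p c / p.kpa + (c.mu + p.kpa) / p.kpa)|

/-- The bound on the attitude error. -/
def thetaMax (p : Params) (c : Consts) : ℝ :=
  min (min (thetaMax1 p c) (thetaMax2 p c)) (Real.pi / 2 - c.xi)

end AerialManip

end

/-!
The proof is by one quadratic Lyapunov function (`Params.lyap`), kinetic energy plus the elastic
energy of the proportional gains, minus `κ` times the bilinear form `eᵀ M(q) v` of the position
error `e` and the velocity `v`. Since `M' = C + Cᵀ`, its rate along trajectories is an explicit
quadratic expression in `(e, v)` plus a term linear in the disturbance `δ`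
(`Params.hasDerivWithinAt_lyap`). Choosing the constant weight `κ = γ_p / (1 + q_max)` instead of
`γ_p / (1 + ‖e‖)` costs nothing where `‖e‖ < q_max`, and the inequalities defining the admissible
constants say that each coefficient of the quadratic expression is then below `-μ`
(`Admissible.lyapRate_le`). The condition `γ_p² λ_M < k_{p,α}` makes the function comparable to the
squared norm of the state (`Params.exists_lyap_bounds`).

The disturbance satisfies `|δ| ≤ D |w|` because `γ` is tuned so that the desired attitude saturates
at `±π / 2` exactly at the force `±Tmax L`; hence `un cos θ_d` vanishes outside a compact interval
of forces, and on it is a quotient of smooth functions (`Params.un_mul_cos_eq`). Grönwall's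
inequality for right derivatives then gives an exponential ISS estimate with constants independent
of the desired configuration (`Admissible.exists_iss_bound`). Evaluated up to the first time at
which the restriction on `e` could fail, it shows that small data keep the restriction.

For the asymptotic gain, `β_d` has a right derivative because saturation preserves right
differentiability, and its size is at most `A (‖(e, v)‖ + ‖(e, v)‖² + |w|)`
(`Params.exists_hasDerivWithinAt_betaD`). The ISS estimate restarted at late times bounds the state
by a multiple of the asymptotic size of `w`, and the restriction `|w| < θ_max` turns the quadratic
term into a linear one with a uniform constant.

Global solutions need an argument of their own, as the restriction on `e` is not available and the
Coriolis term is quadratic in `v`. For `κ = 0` the Lyapunov function grows at most exponentially, so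
the vector field may be truncated outside a ball of exponentially growing radius; the truncated
field is bounded and Lipschitz on bounded time intervals (`exists_global_solution`), and the energy
bound shows that the truncation is never active (`Params.exists_isTraj`).
-/

noncomputable section

namespace AerialManip

/-! ### Norms and the inertia matrix -/

theorem quadratic_form_nonneg {a b c : ℝ} (ha : 0 < a) (h : b ^ 2 ≤ a * c) (x y : ℝ) :
    0 ≤ a * x ^ 2 + 2 * b * x * y + c * y ^ 2 := by
  have h1 : 0 ≤ a * (a * x ^ 2 + 2 * b * x * y + c * y ^ 2) := by
    nlinarith [sq_nonneg (a * x + b * y), mul_nonneg (sub_nonneg.2 h) (sq_nonneg y)]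
  exact nonneg_of_mul_nonneg_right h1 ha

theorem nrm_sq (x : Fin 2 → ℝ) : nrm x ^ 2 = x 0 ^ 2 + x 1 ^ 2 := by
  simp [nrm, EuclideanSpace.norm_sq_eq, Fin.sum_univ_two]

theorem nrm_nonneg (x : Fin 2 → ℝ) : 0 ≤ nrm x := norm_nonneg _

theorem continuous_nrm : Continuous nrm :=
  continuous_norm.comp (PiLp.continuous_toLp 2 _)

theorem nrmPair_nonneg (e v : Fin 2 → ℝ) : 0 ≤ nrmPair e v := Real.sqrt_nonneg _

theorem nrmPair_sq (e v : Fin 2 → ℝ) :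
    nrmPair e v ^ 2 = e 0 ^ 2 + e 1 ^ 2 + (v 0 ^ 2 + v 1 ^ 2) := by
  rw [nrmPair, Real.sq_sqrt (by positivity), nrm_sq, nrm_sq]

theorem nrm_le_nrmPair (e v : Fin 2 → ℝ) : nrm e ≤ nrmPair e v := by
  refine Real.le_sqrt_of_sq_le ?_
  nlinarith [sq_nonneg (nrm v)]

namespace Params

variable (p : Params)

theorem Mt_pos : 0 < p.Mt := by
  have := p.ma_pos; have := p.mb_pos; have := p.ms_pos
  unfold Mt; positivity

theorem Ma_pos : 0 < p.Ma := by
  have := p.ma_pos; have := p.mb_pos; have := p.L_pos; have := p.dG_pos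
  unfold Ma; positivity

theorem I0_pos : 0 < p.I0 := by
  have := p.ma_pos; have := p.mb_pos; have := p.L_pos; have := p.dG_pos; have := p.Ib_pos
  unfold I0; positivity

theorem MaL_pos : 0 < p.Ma * p.L := mul_pos p.Ma_pos p.L_pos

theorem I0L_pos : 0 < p.I0 * p.L := mul_pos p.I0_pos p.L_pos

theorem kpx_pos : 0 < p.kpx := p.kpa_pos.trans p.kpa_lt

theorem kvx_pos : 0 < p.kvx := p.kva_pos.trans p.kva_lt

/-- The inertia matrix is uniformly positive definite: Cauchy-Schwarz for the mass distribution
`(mb, dG), (ma, L)`, with room left by the mass of the UGV. -/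
theorem sq_MaL_lt : (p.Ma * p.L) ^ 2 < p.Mt * (p.I0 * p.L) := by
  have h1 := p.ma_pos; have h2 := p.mb_pos; have h3 := p.L_pos; have h4 := p.dG_pos
  have h5 := p.Ib_pos; have h6 := p.ms_pos
  have e1 : p.Ma * p.L = p.mb * p.dG + p.ma * p.L := by unfold Ma; field_simp
  have e2 : p.I0 * p.L = p.mb * p.dG ^ 2 + p.Ib + p.ma * p.L ^ 2 := by unfold I0; field_simp
  rw [e1, e2, Mt]
  have : 0 < p.ms * (p.mb * p.dG ^ 2 + p.Ib + p.ma * p.L ^ 2) + (p.mb + p.ma) * p.Ib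
      + p.ma * p.mb * (p.dG - p.L) ^ 2 := by positivity
  linarith

theorem sq_MaL_sin_le (a : ℝ) : (p.Ma * p.L * Real.sin a) ^ 2 ≤ (p.Ma * p.L) ^ 2 := by
  rw [mul_pow]
  exact mul_le_of_le_one_right (sq_nonneg _) (Real.sin_sq_le_one a)

theorem inertia_det_pos (a : ℝ) :
    0 < p.Mt * (p.I0 * p.L) - (p.Ma * p.L * Real.sin a) ^ 2 := by
  linarith [p.sq_MaL_lt, p.sq_MaL_sin_le a]

/-- The symmetric bilinear form `xᵀ M y` of the inertia matrix at inclination `a`. -/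
def inertiaForm (a : ℝ) (x y : Fin 2 → ℝ) : ℝ :=
  p.Mt * x 0 * y 0 - p.Ma * p.L * Real.sin a * (x 0 * y 1 + x 1 * y 0)
    + p.I0 * p.L * x 1 * y 1

/-- A uniform lower bound for the eigenvalues of the inertia matrix (determinant over trace). -/
def lamLow : ℝ := (p.Mt * (p.I0 * p.L) - (p.Ma * p.L) ^ 2) / (p.Mt + p.I0 * p.L)

theorem lamLow_pos : 0 < p.lamLow :=
  div_pos (sub_pos.2 p.sq_MaL_lt) (add_pos p.Mt_pos p.I0L_pos)

theorem lamLow_mul_le (a : ℝ) (x : Fin 2 → ℝ) :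
    p.lamLow * (x 0 ^ 2 + x 1 ^ 2) ≤ p.inertiaForm a x x := by
  have hA := p.Mt_pos
  have hJ := p.I0L_pos
  have hl : p.lamLow * (p.Mt + p.I0 * p.L) = p.Mt * (p.I0 * p.L) - (p.Ma * p.L) ^ 2 :=
    div_mul_cancel₀ _ (add_pos hA hJ).ne'
  have h1 := p.lamLow_pos
  have h2 : 0 < p.Mt - p.lamLow := by
    by_contra h
    nlinarith [p.MaL_pos]
  have := quadratic_form_nonneg (a := p.Mt - p.lamLow) (b := -(p.Ma * p.L * Real.sin a))
    (c := p.I0 * p.L - p.lamLow) h2 (by nlinarith [p.sq_MaL_sin_le a]) (x 0) (x 1)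
  unfold inertiaForm
  linarith

theorem mem_spectrum_M_iff (q : Fin 2 → ℝ) (l : ℝ) :
    l ∈ spectrum ℝ (p.M q) ↔
      (l - p.Mt) * (l - p.I0 * p.L) = (p.Ma * p.L * Real.sin (q 1)) ^ 2 := by
  rw [spectrum.mem_iff, Matrix.isUnit_iff_isUnit_det, isUnit_iff_ne_zero, not_not,
    Matrix.det_fin_two]
  simp [M, Matrix.algebraMap_matrix_apply, ← sub_eq_zero (b := (_ : ℝ) ^ 2)]
  ring_nf

theorem bddAbove_spectrum_M : BddAbove (⋃ q : Fin 2 → ℝ, spectrum ℝ (p.M q)) := by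
  refine ⟨p.Mt + p.I0 * p.L, ?_⟩
  rintro l hl
  obtain ⟨q, hq⟩ := Set.mem_iUnion.1 hl
  rw [mem_spectrum_M_iff] at hq
  by_contra h
  have h1 := p.Mt_pos
  have h2 := p.I0L_pos
  nlinarith [p.inertia_det_pos (q 1), mul_pos (sub_pos.2 (not_le.1 h)) (sub_pos.2 (not_le.1 h)),
    mul_pos (sub_pos.2 (not_le.1 h)) h1, mul_pos (sub_pos.2 (not_le.1 h)) h2]

/-- The larger root of the characteristic polynomial bounds the quadratic form, hence so does the
supremum of all eigenvalues. -/
theorem inertiaForm_self_le (a : ℝ) (x : Fin 2 → ℝ) :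
    p.inertiaForm a x x ≤ lamMaxM p * (x 0 ^ 2 + x 1 ^ 2) := by
  set A := p.Mt
  set J := p.I0 * p.L
  set m := p.Ma * p.L * Real.sin a with hm
  set r := Real.sqrt ((A - J) ^ 2 + 4 * m ^ 2) with hr
  have hr2 : r ^ 2 = (A - J) ^ 2 + 4 * m ^ 2 := Real.sq_sqrt (by positivity)
  have hr0 : 0 ≤ r := Real.sqrt_nonneg _
  set l := (A + J + r) / 2 with hl
  have hlm : l ≤ lamMaxM p := by
    refine le_csSup p.bddAbove_spectrum_M (Set.mem_iUnion.2 ⟨![0, a], ?_⟩)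
    rw [mem_spectrum_M_iff]
    have e : (![0, a] : Fin 2 → ℝ) 1 = a := rfl
    rw [e, ← hm]
    change (l - A) * (l - J) = m ^ 2
    rw [hl]
    nlinarith
  have hAJ : |A - J| ≤ r := Real.abs_le_sqrt (by nlinarith [sq_nonneg m])
  have h1 : 0 ≤ l - A := by rw [hl]; linarith [abs_le.1 hAJ]
  have h2 : 0 ≤ l - J := by rw [hl]; linarith [abs_le.1 hAJ]
  have h3 : (l - A) * (l - J) = m ^ 2 := by rw [hl]; nlinarith
  have key : p.inertiaForm a x x ≤ l * (x 0 ^ 2 + x 1 ^ 2) := by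
    have e : l * (x 0 ^ 2 + x 1 ^ 2) - p.inertiaForm a x x
        = (l - A) * x 0 ^ 2 + 2 * m * x 0 * x 1 + (l - J) * x 1 ^ 2 := by
      unfold inertiaForm; ring
    rcases h1.eq_or_lt with h0 | h0
    · have hm0 : m = 0 := by rw [← h0] at h3; simpa using h3.symm
      rw [← h0, hm0] at e
      have : 0 ≤ (l - J) * x 1 ^ 2 := by positivity
      linarith
    · linarith [quadratic_form_nonneg h0 h3.ge (x 0) (x 1)]
  exact key.trans (mul_le_mul_of_nonneg_right hlm (by positivity))

theorem lamMaxM_pos : 0 < lamMaxM p := by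
  have := p.inertiaForm_self_le 0 ![1, 0]
  simp [inertiaForm] at this
  exact p.Mt_pos.trans_le this

/-! ### The attitude map and the disturbance -/

/-- Saturation of the tangential force at `±Tmax L`. -/
def clampForce (f : ℝ) : ℝ := max (-(p.Tmax * p.L)) (min (p.Tmax * p.L) f)

/-- The attitude map before saturation. -/
def rawTheta (f : ℝ) : ℝ := p.gam * Real.arctan (p.eps * f)

theorem TL_pos : 0 < p.Tmax * p.L := mul_pos p.Tmax_pos p.L_pos

theorem arctan_TL_pos : 0 < Real.arctan (p.eps * p.Tmax * p.L) :=
  Real.arctan_pos.2 (mul_pos (mul_pos p.eps_pos p.Tmax_pos) p.L_pos)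

theorem gam_pos : 0 < p.gam :=
  div_pos Real.pi_pos (mul_pos two_pos p.arctan_TL_pos)

theorem rawTheta_TL : p.rawTheta (p.Tmax * p.L) = Real.pi / 2 := by
  have := p.arctan_TL_pos.ne'
  rw [rawTheta, gam, ← mul_assoc]
  field_simp

theorem rawTheta_neg (f : ℝ) : p.rawTheta (-f) = -p.rawTheta f := by
  simp [rawTheta, Real.arctan_neg]

theorem strictMono_rawTheta : StrictMono p.rawTheta := fun _ _ h =>
  mul_lt_mul_of_pos_left (Real.arctan_strictMono (mul_lt_mul_of_pos_left h p.eps_pos)) p.gam_pos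

theorem rawTheta_zero : p.rawTheta 0 = 0 := by simp [rawTheta]

theorem contDiff_rawTheta {n : WithTop ℕ∞} : ContDiff ℝ n p.rawTheta := by
  exact contDiff_const.mul (Real.contDiff_arctan.comp (contDiff_const.mul contDiff_id))

theorem hasDerivAt_rawTheta (f : ℝ) :
    HasDerivAt p.rawTheta (p.gam * (1 / (1 + (p.eps * f) ^ 2) * p.eps)) f := by
  have h := ((hasDerivAt_id f).const_mul p.eps).arctan.const_mul p.gam
  rw [mul_one] at h
  exact h

end Params

theorem sat_eq_clamp {l : ℝ} (hl : 0 ≤ l) (y : ℝ) : sat l y = max (-l) (min l y) := by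
  unfold sat
  rcases lt_trichotomy y 0 with h | rfl | h
  · rw [Real.sign_of_neg h, abs_of_neg h, neg_one_mul, min_eq_right (h.le.trans hl),
      ← max_neg_neg, neg_neg, max_comm]
  · simp [hl]
  · rw [Real.sign_of_pos h, abs_of_pos h, one_mul, min_comm, max_eq_right]
    exact (neg_nonpos.2 hl).trans (le_min hl h.le)

namespace Params

variable (p : Params)

theorem clampForce_mem (f : ℝ) :
    p.clampForce f ∈ Set.Icc (-(p.Tmax * p.L)) (p.Tmax * p.L) :=
  ⟨le_max_left _ _, max_le (by linarith [p.TL_pos]) (min_le_left _ _)⟩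

/-- The saturation of the angle may be moved to the force, because `γ` is chosen so that the
unsaturated map reaches `π / 2` exactly at the force `Tmax L`. -/
theorem thetaD_eq (f : ℝ) : p.thetaD f = p.rawTheta (p.clampForce f) := by
  rw [thetaD, sat_eq_clamp (by positivity), clampForce, p.strictMono_rawTheta.monotone.map_max,
    p.strictMono_rawTheta.monotone.map_min, rawTheta_neg, rawTheta_TL]
  rfl

theorem clampForce_of_mem {f : ℝ} (h : f ∈ Set.Icc (-(p.Tmax * p.L)) (p.Tmax * p.L)) :
    p.clampForce f = f := by
  rw [clampForce, min_eq_right h.2, max_eq_right h.1]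

theorem clampForce_of_notMem {f : ℝ} (h : f ∉ Set.Icc (-(p.Tmax * p.L)) (p.Tmax * p.L)) :
    p.clampForce f = p.Tmax * p.L ∨ p.clampForce f = -(p.Tmax * p.L) := by
  have := p.TL_pos
  rcases lt_or_ge f (-(p.Tmax * p.L)) with h1 | h1
  · right
    rw [clampForce, min_eq_right (by linarith), max_eq_left h1.le]
  · left
    have h2 : p.Tmax * p.L < f := not_le.1 fun h2 => h ⟨h1, h2⟩
    rw [clampForce, min_eq_left h2.le, max_eq_right (by linarith)]

theorem abs_clampForce_sub_le (f f' : ℝ) : |p.clampForce f - p.clampForce f'| ≤ |f - f'| := by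
  unfold clampForce
  refine (abs_max_sub_max_le_max _ _ _ _).trans ?_
  simpa using abs_min_sub_min_le_max (p.Tmax * p.L) f (p.Tmax * p.L) f'

theorem cos_rawTheta_TL : Real.cos (p.rawTheta (p.Tmax * p.L)) = 0 := by
  rw [rawTheta_TL, Real.cos_pi_div_two]

theorem sin_rawTheta_ne_zero {f : ℝ} (h : f ∈ Set.Icc (-(p.Tmax * p.L)) (p.Tmax * p.L))
    (h0 : f ≠ 0) : Real.sin (p.rawTheta f) ≠ 0 := by
  have hm := p.strictMono_rawTheta
  have h1 := hm.monotone h.1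
  have h2 := hm.monotone h.2
  rw [rawTheta_neg, rawTheta_TL] at h1
  rw [rawTheta_TL] at h2
  have h3 : p.rawTheta f ≠ 0 := fun h => h0 (hm.injective (h.trans p.rawTheta_zero.symm))
  intro h4
  have hpi := Real.pi_pos
  exact h3 ((Real.sin_eq_zero_iff_of_lt_of_lt (by linarith) (by linarith)).1 h4)

/-- The factor `un cos θ_d` of the disturbance `δ`, before saturation of the force. The difference
quotient of `sin θ` at `0` has its limit `γ ε` as value at `0`, in agreement with `un`. -/
def rawCotForce (f : ℝ) : ℝ :=
  Real.cos (p.rawTheta f) / dslope (fun x => Real.sin (p.rawTheta x)) 0 f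

theorem dslope_sin_rawTheta_zero :
    dslope (fun x => Real.sin (p.rawTheta x)) 0 0 = p.gam * p.eps := by
  have h := (p.hasDerivAt_rawTheta 0).sin
  rw [dslope_same, h.deriv, rawTheta_zero]
  simp

theorem dslope_sin_rawTheta_of_ne {f : ℝ} (h : f ≠ 0) :
    dslope (fun x => Real.sin (p.rawTheta x)) 0 f = Real.sin (p.rawTheta f) / f := by
  rw [dslope_of_ne _ h, slope_def_field, rawTheta_zero]
  simp

/-- For saturated forces both sides vanish, since `cos θ_d = 0` there. -/
theorem un_mul_cos_eq (f : ℝ) :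
    p.un f * Real.cos (p.thetaD f) = p.rawCotForce (p.clampForce f) := by
  rw [thetaD_eq]
  by_cases h : f ∈ Set.Icc (-(p.Tmax * p.L)) (p.Tmax * p.L)
  · rw [un, thetaD_eq, p.clampForce_of_mem h, rawCotForce]
    split_ifs with h0
    · subst h0
      rw [dslope_sin_rawTheta_zero]
      ring
    · rw [dslope_sin_rawTheta_of_ne _ h0]
      have := p.sin_rawTheta_ne_zero h h0
      field_simp
  · have : Real.cos (p.rawTheta (p.clampForce f)) = 0 := by
      rcases p.clampForce_of_notMem h with h1 | h1
      · rw [h1, cos_rawTheta_TL]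
      · rw [h1, rawTheta_neg, Real.cos_neg, cos_rawTheta_TL]
    rw [rawCotForce, this]
    simp

theorem contDiffAt_dslope_sin_rawTheta (f : ℝ) :
    ContDiffAt ℝ 1 (dslope (fun x => Real.sin (p.rawTheta x)) 0) f := by
  have hc : ∀ {n : WithTop ℕ∞}, ContDiff ℝ n (fun x => Real.sin (p.rawTheta x)) :=
    Real.contDiff_sin.comp p.contDiff_rawTheta
  rcases eq_or_ne f 0 with rfl | h
  · obtain ⟨s, hs⟩ := (hc (n := ⊤)).contDiffAt.analyticAt (x := (0 : ℝ))
    exact hs.has_fpower_series_dslope_fslope.analyticAt.contDiffAt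
  · have h1 : ContDiffAt ℝ 1 (fun x => Real.sin (p.rawTheta x) / x) f :=
      hc.contDiffAt.div contDiffAt_id h
    refine h1.congr_of_eventuallyEq ?_
    filter_upwards [isOpen_ne.mem_nhds h] with x hx
    exact p.dslope_sin_rawTheta_of_ne hx

theorem exists_lipschitzOnWith_rawCotForce :
    ∃ K, LipschitzOnWith K p.rawCotForce (Set.Icc (-(p.Tmax * p.L)) (p.Tmax * p.L)) := by
  refine LocallyLipschitzOn.exists_lipschitzOnWith_of_compact isCompact_Icc ?_
  intro f hf
  have h0 : dslope (fun x => Real.sin (p.rawTheta x)) 0 f ≠ 0 := by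
    rcases eq_or_ne f 0 with rfl | h
    · rw [dslope_sin_rawTheta_zero]
      exact (mul_pos p.gam_pos p.eps_pos).ne'
    · rw [dslope_sin_rawTheta_of_ne _ h]
      exact div_ne_zero (p.sin_rawTheta_ne_zero hf h) h
  have h1 : ContDiffAt ℝ 1 p.rawCotForce f :=
    (Real.contDiff_cos.comp p.contDiff_rawTheta).contDiffAt.div
      (p.contDiffAt_dslope_sin_rawTheta f) h0
  obtain ⟨K, t, ht, hK⟩ := h1.exists_lipschitzOnWith
  exact ⟨K, t, mem_nhdsWithin_of_mem_nhds ht, hK⟩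

/-- The factor `un cos θ_d` of the disturbance is a Lipschitz function of the force. -/
theorem exists_lipschitzWith_un_mul_cos :
    ∃ K, LipschitzWith K fun f => p.un f * Real.cos (p.thetaD f) := by
  obtain ⟨K, hK⟩ := p.exists_lipschitzOnWith_rawCotForce
  refine ⟨K, LipschitzWith.of_dist_le_mul fun f f' => ?_⟩
  rw [un_mul_cos_eq, un_mul_cos_eq]
  refine (hK.dist_le_mul _ (p.clampForce_mem f) _ (p.clampForce_mem f')).trans ?_
  exact mul_le_mul_of_nonneg_left (p.abs_clampForce_sub_le f f') K.2

theorem exists_abs_un_mul_cos_le : ∃ D > 0, ∀ f, |p.un f * Real.cos (p.thetaD f)| ≤ D := by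
  obtain ⟨K, hK⟩ := p.exists_lipschitzOnWith_rawCotForce
  obtain ⟨D, hD⟩ := isCompact_Icc.exists_bound_of_continuousOn hK.continuousOn
  refine ⟨max D 1, by positivity, fun f => ?_⟩
  rw [un_mul_cos_eq]
  exact (hD _ (p.clampForce_mem f)).trans (le_max_left _ _)

/-- The disturbance `δ` is bounded by a multiple of the attitude error, uniformly in the state. -/
theorem exists_abs_delta_le : ∃ D > 0, ∀ qd q v w, |p.delta qd q v w 1| ≤ D * |w| := by
  obtain ⟨D, hD, h⟩ := p.exists_abs_un_mul_cos_le
  have hg : 0 < p.Ma * p.L * p.g := mul_pos p.MaL_pos p.g_pos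
  refine ⟨D + p.Ma * p.L * p.g, by positivity, fun qd q v w => ?_⟩
  have e : p.delta qd q v w 1 = p.un (p.ft qd q v) * Real.cos (p.thetaD (p.ft qd q v)) * Real.sin w
    - 2 * (p.Ma * p.L * p.g * Real.cos (q 1)) * Real.sin (w / 2) ^ 2 := rfl
  rw [e, add_mul]
  refine (abs_sub _ _).trans (add_le_add ?_ ?_)
  · rw [abs_mul]
    exact mul_le_mul (h _) Real.abs_sin_le_abs (abs_nonneg _) hD.le
  · have h1 : Real.sin (w / 2) ^ 2 ≤ |w| / 2 := by
      have h2 : |Real.sin (w / 2)| ≤ |w / 2| := Real.abs_sin_le_abs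
      have h3 := Real.abs_sin_le_one (w / 2)
      rw [abs_div, abs_two] at h2
      rw [← sq_abs]
      nlinarith [abs_nonneg (Real.sin (w / 2))]
    have h4 := Real.abs_cos_le_one (q 1)
    rw [abs_mul, abs_mul, abs_mul (p.Ma * p.L * p.g), abs_two, abs_of_pos hg,
      abs_of_nonneg (sq_nonneg (Real.sin (w / 2)))]
    calc 2 * (p.Ma * p.L * p.g * |Real.cos (q 1)|) * Real.sin (w / 2) ^ 2
        ≤ 2 * (p.Ma * p.L * p.g * 1) * (|w| / 2) := by gcongr
      _ = p.Ma * p.L * p.g * |w| := by ring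

end Params

/-! ### The Lyapunov function -/

namespace Params

variable (p : Params)

/-- The equations of motion in coordinates, with gravity cancelled by its compensation. -/
theorem motion_iff (qd q v a : Fin 2 → ℝ) (w : ℝ) :
    p.M q *ᵥ a + p.C q v *ᵥ v + p.grav q = p.tau qd q v w ↔
      p.Mt * a 0 - p.Ma * p.L * Real.sin (q 1) * a 1 - p.Ma * p.L * Real.cos (q 1) * v 1 ^ 2
        = p.kpx * (qd 0 - q 0) - p.kvx * v 0 ∧
      -(p.Ma * p.L * Real.sin (q 1)) * a 0 + p.I0 * p.L * a 1
        = p.kpa * Real.cos w * (qd 1 - q 1) - p.kva * Real.cos w * v 1 + p.delta qd q v w 1 := by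
  have e : ∀ u : Fin 2 → ℝ, vecHead (vecTail u) = u 1 := fun _ => rfl
  have e' : ∀ {n : ℕ} (u : Fin (n + 1) → ℝ), vecHead u = u 0 := fun _ => rfl
  have d0 : p.delta qd q v w 0 = 0 := rfl
  have g0 : p.grav q 0 = 0 := rfl
  rw [funext_iff, Fin.forall_fin_two]
  simp only [tau, Pi.add_apply, Pi.sub_apply, d0, g0]
  refine and_congr ⟨fun h => ?_, fun h => ?_⟩ ⟨fun h => ?_, fun h => ?_⟩ <;>
    simp [M, C, Kp, Kv, e, e'] at h ⊢ <;> linarith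

/-- The Lyapunov function: kinetic energy, elastic energy of the proportional gains, and a cross
term of weight `κ` that makes the dissipation definite in the position error. -/
def lyap (k : ℝ) (qd q v : Fin 2 → ℝ) : ℝ :=
  p.inertiaForm (q 1) v v / 2 + (p.kpx * (qd 0 - q 0) ^ 2 + p.kpa * (qd 1 - q 1) ^ 2) / 2
    - k * p.inertiaForm (q 1) (qd - q) v

/-- The rate of change of `lyap` along trajectories. -/
def lyapRate (k : ℝ) (qd q v : Fin 2 → ℝ) (w : ℝ) : ℝ :=
  -(p.kvx * v 0 ^ 2 + p.kva * Real.cos w * v 1 ^ 2)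
    - p.kpa * (1 - Real.cos w) * (qd 1 - q 1) * v 1
    + (v 1 - k * (qd 1 - q 1)) * p.delta qd q v w 1
    + k * p.inertiaForm (q 1) v v
    + k * (p.Ma * p.L * Real.cos (q 1) * v 0 * v 1 * (qd 1 - q 1))
    - k * (p.kpx * (qd 0 - q 0) ^ 2 + p.kpa * Real.cos w * (qd 1 - q 1) ^ 2)
    + k * (p.kvx * (qd 0 - q 0) * v 0 + p.kva * Real.cos w * (qd 1 - q 1) * v 1)

theorem hasDerivWithinAt_lyap (k : ℝ) {qd : Fin 2 → ℝ} {q v : ℝ → Fin 2 → ℝ} {a : Fin 2 → ℝ}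
    {w t : ℝ} {S : Set ℝ} (hq : HasDerivWithinAt q (v t) S t) (hv : HasDerivWithinAt v a S t)
    (h : p.M (q t) *ᵥ a + p.C (q t) (v t) *ᵥ v t + p.grav (q t) = p.tau qd (q t) (v t) w) :
    HasDerivWithinAt (fun s => p.lyap k qd (q s) (v s)) (p.lyapRate k qd (q t) (v t) w) S t := by
  obtain ⟨h0, h1⟩ := (p.motion_iff qd (q t) (v t) a w).1 h
  have q0 := hasDerivWithinAt_pi.1 hq 0
  have q1 := hasDerivWithinAt_pi.1 hq 1
  have v0 := hasDerivWithinAt_pi.1 hv 0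
  have v1 := hasDerivWithinAt_pi.1 hv 1
  have e0 := q0.const_sub (qd 0)
  have e1 := q1.const_sub (qd 1)
  have m : ∀ {x0 x1 y0 y1 : ℝ → ℝ} {a0 a1 b0 b1 : ℝ}, HasDerivWithinAt x0 a0 S t →
      HasDerivWithinAt x1 a1 S t → HasDerivWithinAt y0 b0 S t → HasDerivWithinAt y1 b1 S t →
      HasDerivWithinAt (fun s => p.Mt * x0 s * y0 s
        - p.Ma * p.L * Real.sin (q s 1) * (x0 s * y1 s + x1 s * y0 s) + p.I0 * p.L * x1 s * y1 s)
        (p.Mt * (a0 * y0 t + x0 t * b0)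
        - (p.Ma * p.L * (Real.cos (q t 1) * v t 1) * (x0 t * y1 t + x1 t * y0 t)
          + p.Ma * p.L * Real.sin (q t 1) * (a0 * y1 t + x0 t * b1 + (a1 * y0 t + x1 t * b0)))
        + p.I0 * p.L * (a1 * y1 t + x1 t * b1)) S t := by
    intro x0 x1 y0 y1 a0 a1 b0 b1 hx0 hx1 hy0 hy1
    have := (((hx0.const_mul p.Mt).mul hy0).sub
      ((q1.sin.const_mul (p.Ma * p.L)).mul ((hx0.mul hy1).add (hx1.mul hy0)))).add
      ((hx1.const_mul (p.I0 * p.L)).mul hy1)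
    refine this.congr_deriv ?_
    simp only [Pi.add_apply, Pi.mul_apply]
    ring
  have key := (((m v0 v1 v0 v1).div_const 2).add
    ((((e0.pow 2).const_mul p.kpx).add ((e1.pow 2).const_mul p.kpa)).div_const 2)).sub
    ((m e0 e1 v0 v1).const_mul k)
  refine key.congr_deriv ?_
  simp only [lyapRate, inertiaForm, Nat.cast_ofNat]
  linear_combination (v t 0 - k * (qd 0 - q t 0)) * h0 + (v t 1 - k * (qd 1 - q t 1)) * h1

theorem continuousOn_lyap (k : ℝ) {qd : Fin 2 → ℝ} {q v : ℝ → Fin 2 → ℝ} {S : Set ℝ}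
    (hq : ContinuousOn q S) (hv : ContinuousOn v S) :
    ContinuousOn (fun s => p.lyap k qd (q s) (v s)) S := by
  have q0 := continuousOn_pi.1 hq 0
  have q1 := continuousOn_pi.1 hq 1
  have v0 := continuousOn_pi.1 hv 0
  have v1 := continuousOn_pi.1 hv 1
  simp only [lyap, inertiaForm, Pi.sub_apply]
  fun_prop

theorem inertiaForm_sub_smul (s k a : ℝ) (x y : Fin 2 → ℝ) :
    p.inertiaForm a (s • x - k • y) (s • x - k • y) =
      s ^ 2 * p.inertiaForm a x x - 2 * s * k * p.inertiaForm a y x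
        + k ^ 2 * p.inertiaForm a y y := by
  simp only [inertiaForm, Pi.sub_apply, Pi.smul_apply, smul_eq_mul]
  ring

theorem inertiaForm_self_nonneg (a : ℝ) (x : Fin 2 → ℝ) : 0 ≤ p.inertiaForm a x x :=
  (mul_nonneg p.lamLow_pos.le (by positivity)).trans (p.lamLow_mul_le a x)

/-- If `κ² λ_M < k_{p,α}`, the cross term is dominated, and `lyap` is comparable to the squared norm
of the state. -/
theorem exists_lyap_bounds {k : ℝ} (hk : k ^ 2 * lamMaxM p < p.kpa) :
    ∃ c₁ > 0, ∃ c₂ > 0, ∀ qd q v : Fin 2 → ℝ, c₁ * nrmPair (qd - q) v ^ 2 ≤ p.lyap k qd q v ∧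
      p.lyap k qd q v ≤ c₂ * nrmPair (qd - q) v ^ 2 := by
  have hkp := p.kpa_pos
  have hkx := p.kpx_pos
  have hlM := p.lamMaxM_pos
  -- a weight `s` strictly between `κ² λ_M / k_{p,α}` and `1` for Young's inequality
  obtain ⟨s, hs1, hs2⟩ := exists_between ((div_lt_one hkp).2 hk)
  have hs0 : 0 < s := lt_of_le_of_lt (by positivity) hs1
  have hs3 : k ^ 2 * lamMaxM p < s * p.kpa := (div_lt_iff₀ hkp).1 hs1
  have hs4 : 0 < p.kpa - k ^ 2 * lamMaxM p / s := by
    rw [sub_pos, div_lt_iff₀ hs0]; linarith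
  have hl := p.lamLow_pos
  have hs5 : 0 < (1 - s) * p.lamLow := mul_pos (by linarith) hl
  refine ⟨min ((1 - s) * p.lamLow) (p.kpa - k ^ 2 * lamMaxM p / s) / 2,
    half_pos (lt_min hs5 hs4), lamMaxM p + (k ^ 2 * lamMaxM p + p.kpx) / 2, by positivity,
    fun qd q v => ?_⟩
  set e := qd - q with he
  have e0 : qd 0 - q 0 = e 0 := rfl
  have e1 : qd 1 - q 1 = e 1 := rfl
  rw [nrmPair_sq, lyap, ← he, e0, e1]
  have hee := p.inertiaForm_self_le (q 1) e
  have hvv := p.inertiaForm_self_le (q 1) v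
  have hvl := p.lamLow_mul_le (q 1) v
  have hE : 0 ≤ e 0 ^ 2 + e 1 ^ 2 := by positivity
  have hN : 0 ≤ v 0 ^ 2 + v 1 ^ 2 := by positivity
  constructor
  · have h1 : 2 * k * p.inertiaForm (q 1) e v
        ≤ s * p.inertiaForm (q 1) v v + k ^ 2 / s * p.inertiaForm (q 1) e e := by
      have h := p.inertiaForm_self_nonneg (q 1) (s • v - k • e)
      rw [inertiaForm_sub_smul] at h
      have h2 : 0 ≤ (s ^ 2 * p.inertiaForm (q 1) v v - 2 * s * k * p.inertiaForm (q 1) e v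
        + k ^ 2 * p.inertiaForm (q 1) e e) / s := by positivity
      have h3 : (s ^ 2 * p.inertiaForm (q 1) v v - 2 * s * k * p.inertiaForm (q 1) e v
        + k ^ 2 * p.inertiaForm (q 1) e e) / s = s * p.inertiaForm (q 1) v v
          - 2 * k * p.inertiaForm (q 1) e v + k ^ 2 / s * p.inertiaForm (q 1) e e := by
        field_simp
      linarith
    have h2 : k ^ 2 / s * p.inertiaForm (q 1) e e
        ≤ k ^ 2 * lamMaxM p / s * (e 0 ^ 2 + e 1 ^ 2) :=
      (mul_le_mul_of_nonneg_left hee (by positivity)).trans_eq (by ring)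
    have h3 := mul_le_mul_of_nonneg_left hvl (sub_nonneg.2 hs2.le)
    have h4 := mul_le_mul_of_nonneg_right
      (min_le_left ((1 - s) * p.lamLow) (p.kpa - k ^ 2 * lamMaxM p / s)) hN
    have h5 := mul_le_mul_of_nonneg_right
      (min_le_right ((1 - s) * p.lamLow) (p.kpa - k ^ 2 * lamMaxM p / s)) hE
    nlinarith [mul_nonneg (sub_nonneg.2 p.kpa_lt.le) (sq_nonneg (e 0))]
  · have h := p.inertiaForm_self_nonneg (q 1) ((1 : ℝ) • v - (-k) • e)
    rw [inertiaForm_sub_smul] at h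
    have h2 := mul_le_mul_of_nonneg_left hee (sq_nonneg k)
    have h3 := mul_nonneg (sub_nonneg.2 p.kpa_lt.le) (sq_nonneg (e 1))
    have h4 := mul_nonneg (mul_nonneg (sq_nonneg k) hlM.le) hN
    have h5 := mul_nonneg hkx.le hN
    have h6 := mul_nonneg hlM.le hE
    linarith

end Params

/-! ### Dissipation under the restrictions -/

/-- The weight of the cross term of the Lyapunov function. Freezing the factor `1 / (1 + ‖e‖)` at
its smallest value over the region of interest makes the cross term bilinear. -/
def crossWeight (c : Consts) : ℝ := c.gp / (1 + qMax c)

namespace Admissible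

variable {p : Params} {c : Consts}
theorem qMax_pos (h : Admissible p c) : 0 < qMax c := lt_min h.q1_pos h.q2_pos

theorem sin_xi_pos (h : Admissible p c) : 0 < Real.sin c.xi :=
  Real.sin_pos_of_pos_of_lt_pi h.xi_pos (by linarith [h.xi_lt, Real.pi_pos])

theorem gp_sq_mul_lt (h : Admissible p c) : c.gp ^ 2 * lamMaxM p < p.kpa := by
  have h1 : c.gp < Real.sqrt (p.kpa / lamMaxM p) :=
    h.gp_lt.trans_le ((min_le_left _ _).trans (min_le_left _ _))
  rw [Real.lt_sqrt h.gp_pos.le, lt_div_iff₀ p.lamMaxM_pos] at h1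
  exact h1

theorem mu_lt_dampMargin (h : Admissible p c) : c.mu < dampMargin p c :=
  h.mu_lt.trans_le ((min_le_left _ _).trans (min_le_left _ _))

theorem qMax_le_q1 : qMax c ≤ c.q1 := min_le_left _ _

theorem qMax_le_q2 : qMax c ≤ c.q2 := min_le_right _ _

theorem crossWeight_pos (h : Admissible p c) : 0 < crossWeight c := div_pos h.gp_pos (by linarith [h.qMax_pos])

theorem crossWeight_le (h : Admissible p c) : crossWeight c ≤ c.gp :=
  div_le_self h.gp_pos.le (by linarith [h.qMax_pos])

theorem crossWeight_mul_le (h : Admissible p c) : crossWeight c * qMax c ≤ c.gp := by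
  have := h.qMax_pos
  have := h.gp_pos
  rw [crossWeight, div_mul_eq_mul_div, div_le_iff₀ (by linarith)]
  nlinarith

theorem crossWeight_sq_mul_lt (h : Admissible p c) : crossWeight c ^ 2 * lamMaxM p < p.kpa := by
  refine lt_of_le_of_lt (mul_le_mul_of_nonneg_right ?_ p.lamMaxM_pos.le) h.gp_sq_mul_lt
  exact pow_le_pow_left₀ h.crossWeight_pos.le h.crossWeight_le 2

theorem mu_lt_x (h : Admissible p c) : c.mu < c.gp * p.kpx / (1 + c.q1) - c.gp ^ 2 * p.kvx / 2 := by
  have h1 := h.q1_lt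
  have h2 := h.q1_pos
  have h3 := h.mu_pos
  have h4 := p.kvx_pos
  have h5 := h.gp_pos
  rw [lt_sub_iff_add_lt, lt_div_iff₀ (by positivity)] at h1
  rw [lt_sub_iff_add_lt, lt_div_iff₀ (by positivity)]
  linarith

theorem mu_lt_a (h : Admissible p c) : c.mu < c.gp * p.kpa / (1 + c.q2) - c.gp ^ 2 * p.kva / 2 := by
  have h1 := h.q2_lt
  have h2 := h.q2_pos
  have h3 := h.mu_pos
  have h4 := p.kva_pos
  have h5 := h.gp_pos
  rw [lt_sub_iff_add_lt, lt_div_iff₀ (by positivity)] at h1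
  rw [lt_sub_iff_add_lt, lt_div_iff₀ (by positivity)]
  linarith

theorem thetaMax_pos (h : Admissible p c) : 0 < thetaMax p c := by
  have hk := p.kpa_pos
  have hmu := h.mu_pos
  have ha := h.mu_lt_a
  refine lt_min (lt_min ?_ ?_) (by linarith [h.xi_lt])
  · refine abs_pos.2 (Real.arccos_pos.2 ?_).ne'
    rw [div_lt_one (by linarith)]
    linarith
  · refine abs_pos.2 (Real.arccos_pos.2 ?_).ne'
    rw [← add_div, div_lt_one hk]
    linarith [h.mu_lt_dampMargin]

end Admissible

/-- No bounds on `x` are needed: `arccos` is `π` below `-1`, where the claim is trivial, and `0`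
above `1`, where the hypothesis is void. -/
theorem lt_cos_of_abs_lt_arccos {x w : ℝ} (hw : |w| < |Real.arccos x|) : x < Real.cos w := by
  rw [abs_of_nonneg (Real.arccos_nonneg x)] at hw
  have h1 : Real.cos (Real.arccos x) < Real.cos |w| :=
    Real.strictAntiOn_cos ⟨abs_nonneg w, hw.le.trans (Real.arccos_le_pi x)⟩
      ⟨Real.arccos_nonneg x, Real.arccos_le_pi x⟩ hw
  rw [Real.cos_abs] at h1
  rcases le_or_gt (-1) x with h2 | h2
  · rcases le_or_gt x 1 with h3 | h3
    · rwa [Real.cos_arccos h2 h3] at h1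
    · rw [Real.arccos_of_one_le h3.le] at hw
      exact absurd hw (not_lt.2 (abs_nonneg w))
  · exact h2.trans_le (Real.neg_one_le_cos w)

namespace Admissible

variable {p : Params} {c : Consts}
theorem sin_xi_lt_cos (h : Admissible p c) {w : ℝ} (hw : |w| < thetaMax p c) : Real.sin c.xi < Real.cos w := by
  have h1 : |w| < Real.pi / 2 - c.xi := hw.trans_le (min_le_right _ _)
  rw [← Real.cos_abs w, ← Real.cos_pi_div_two_sub]
  exact Real.cos_lt_cos_of_nonneg_of_le_pi_div_two (abs_nonneg w) (by linarith [h.xi_pos]) h1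

theorem mu_lt_of_abs_lt (h : Admissible p c) {w : ℝ} (hw : |w| < thetaMax p c) :
    c.mu < (c.gp * p.kpa / (1 + c.q2) - c.gp ^ 2 * p.kva / 2) * Real.cos w
      - p.kpa * (1 - Real.cos w) := by
  have h1 : |w| < thetaMax1 p c := hw.trans_le ((min_le_left _ _).trans (min_le_left _ _))
  have h2 := lt_cos_of_abs_lt_arccos h1
  rw [div_lt_iff₀ (by linarith [h.mu_lt_a, h.mu_pos, p.kpa_pos])] at h2
  linarith

theorem mu_lt_dampMargin_sub {w : ℝ} (hw : |w| < thetaMax p c) :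
    c.mu < dampMargin p c - p.kpa * (1 - Real.cos w) := by
  have h1 : |w| < thetaMax2 p c := hw.trans_le ((min_le_left _ _).trans (min_le_right _ _))
  have h2 := lt_cos_of_abs_lt_arccos h1
  rw [← add_div, div_lt_iff₀ p.kpa_pos] at h2
  linarith

/-- The bound on the Coriolis force, tested at `q = 0`, `v = (0, 1)`. -/
theorem MaL_le_kc (h : Admissible p c) : p.Ma * p.L ≤ c.kc := by
  have h1 := h.kc_bound 0 ![0, 1]
  have h2 : nrm (![0, 1] : Fin 2 → ℝ) ^ 2 = 1 := by rw [nrm_sq]; simp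
  have h3 : nrm (p.C 0 ![0, 1] *ᵥ ![0, 1]) ^ 2 = (p.Ma * p.L) ^ 2 := by
    rw [nrm_sq]; simp [Params.C]
  rw [h2, mul_one] at h1
  rw [← abs_of_nonneg (nrm_nonneg (p.C 0 ![0, 1] *ᵥ ![0, 1]))] at h1
  exact (abs_of_pos p.MaL_pos).symm.le.trans ((sq_eq_sq_iff_abs_eq_abs _ _).1 h3 ▸ h1)

/-- Dissipation: with the stated restrictions every coefficient of the quadratic form in the rate
of the Lyapunov function stays below `-μ`. -/
theorem lyapRate_le (h : Admissible p c) {qd q v : Fin 2 → ℝ} {w : ℝ} (hw : |w| < thetaMax p c)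
    (hq : nrm (qd - q) < qMax c) :
    p.lyapRate (crossWeight c) qd q v w ≤ -c.mu * nrmPair (qd - q) v ^ 2
      + (v 1 - crossWeight c * (qd 1 - q 1)) * p.delta qd q v w 1 := by
  set k := crossWeight c with hk
  have e0 : (qd - q) 0 = qd 0 - q 0 := rfl
  have e1 : (qd - q) 1 = qd 1 - q 1 := rfl
  rw [nrmPair_sq, Params.lyapRate, e0, e1]
  have hE1 : |qd 1 - q 1| ≤ qMax c := by
    refine (Real.abs_le_sqrt ?_).trans (Real.sqrt_sq (nrm_nonneg (qd - q)) ▸ hq.le)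
    rw [nrm_sq, e0, e1]
    nlinarith [sq_nonneg (qd 0 - q 0)]
  set x0 := qd 0 - q 0
  set x1 := qd 1 - q 1
  set v0 := v 0
  set v1 := v 1
  set cw := Real.cos w
  have hcw1 : cw ≤ 1 := Real.cos_le_one w
  have hs := h.sin_xi_pos
  have hcw : Real.sin c.xi < cw := h.sin_xi_lt_cos hw
  have hk0 : 0 < k := h.crossWeight_pos
  have hkg : k ≤ c.gp := h.crossWeight_le
  have hgp := h.gp_pos
  have hkpa := p.kpa_pos
  have hkva := p.kva_pos
  have hkvx := p.kvx_pos
  have hkpx := p.kpx_pos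
  have hlM := p.lamMaxM_pos
  have hQ := h.qMax_pos
  have hksq : k ^ 2 ≤ c.gp ^ 2 := pow_le_pow_left₀ hk0.le hkg 2
  have hx : c.mu ≤ k * p.kpx - k ^ 2 * p.kvx / 2 := by
    have h1 := h.mu_lt_x
    have h2 : c.gp / (1 + c.q1) ≤ k := by
      have := h.q1_pos
      exact div_le_div_of_nonneg_left hgp.le (by linarith)
        (by linarith [qMax_le_q1 (c := c)])
    have h3 := mul_le_mul_of_nonneg_right h2 hkpx.le
    have h4 := mul_le_mul_of_nonneg_right hksq hkvx.le
    have h5 : c.gp / (1 + c.q1) * p.kpx = c.gp * p.kpx / (1 + c.q1) := by ring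
    linarith
  have ha : c.mu ≤ (k * p.kpa - k ^ 2 * p.kva / 2) * cw - p.kpa * (1 - cw) := by
    have h1 := h.mu_lt_of_abs_lt hw
    have h2 : c.gp / (1 + c.q2) ≤ k := by
      have := h.q2_pos
      exact div_le_div_of_nonneg_left hgp.le (by linarith)
        (by linarith [qMax_le_q2 (c := c)])
    have h3 := mul_le_mul_of_nonneg_right h2 hkpa.le
    have h4 := mul_le_mul_of_nonneg_right hksq hkva.le
    have h5 : c.gp / (1 + c.q2) * p.kpa = c.gp * p.kpa / (1 + c.q2) := by ring
    have h6 := mul_le_mul_of_nonneg_right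
      (show c.gp * p.kpa / (1 + c.q2) - c.gp ^ 2 * p.kva / 2 ≤ k * p.kpa - k ^ 2 * p.kva / 2 by
        linarith) (hs.trans hcw).le
    linarith
  have hP := h.mu_lt_dampMargin
  have hP' := mu_lt_dampMargin_sub hw
  have hPdef : dampMargin p c = p.kva * Real.sin c.xi / 2 - 2 * c.gp * lamMaxM p - c.gp * c.kc :=
    rfl
  have hcor : k * (p.Ma * p.L * Real.cos (q 1) * v0 * v1 * x1)
      ≤ c.gp * c.kc * (v0 ^ 2 + v1 ^ 2) := by
    have h1 : |v0 * v1| ≤ v0 ^ 2 + v1 ^ 2 := by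
      rw [abs_le]
      constructor <;> nlinarith [sq_nonneg (v0 + v1), sq_nonneg (v0 - v1)]
    have hm := p.MaL_pos
    calc k * (p.Ma * p.L * Real.cos (q 1) * v0 * v1 * x1)
        ≤ |k * (p.Ma * p.L * Real.cos (q 1) * v0 * v1 * x1)| := le_abs_self _
      _ = k * |x1| * (p.Ma * p.L) * |Real.cos (q 1)| * |v0 * v1| := by
          simp only [abs_mul, abs_of_pos hk0, abs_of_pos p.Ma_pos, abs_of_pos p.L_pos]; ring
      _ ≤ k * qMax c * c.kc * 1 * (v0 ^ 2 + v1 ^ 2) := by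
          have hkc := h.kc_pos
          gcongr
          · exact h.MaL_le_kc
          · exact Real.abs_cos_le_one _
      _ ≤ c.gp * c.kc * (v0 ^ 2 + v1 ^ 2) := by
          rw [mul_one]
          gcongr
          · exact h.kc_pos.le
          · exact h.crossWeight_mul_le
  have hin : k * p.inertiaForm (q 1) v v ≤ c.gp * lamMaxM p * (v0 ^ 2 + v1 ^ 2) :=
    (mul_le_mul_of_nonneg_left (p.inertiaForm_self_le (q 1) v) hk0.le).trans
      (by rw [mul_assoc]; exact mul_le_mul_of_nonneg_right hkg (by positivity))
  have y1 : k * (p.kvx * x0 * v0) ≤ p.kvx / 2 * v0 ^ 2 + k ^ 2 * p.kvx / 2 * x0 ^ 2 := by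
    linarith only [mul_nonneg hkvx.le (sq_nonneg (v0 - k * x0))]
  have hcp : 0 < cw := hs.trans hcw
  have y2 : k * (p.kva * cw * x1 * v1)
      ≤ p.kva * cw / 2 * v1 ^ 2 + k ^ 2 * p.kva / 2 * cw * x1 ^ 2 := by
    linarith only [mul_nonneg (mul_nonneg hkva.le hcp.le) (sq_nonneg (v1 - k * x1))]
  have hnn : 0 ≤ p.kpa * (1 - cw) := mul_nonneg hkpa.le (by linarith)
  have y3 : -(p.kpa * (1 - cw) * x1 * v1) ≤ p.kpa * (1 - cw) * (x1 ^ 2 + v1 ^ 2) := by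
    linarith only [mul_nonneg hnn (sq_nonneg (x1 + v1)), mul_nonneg hnn (sq_nonneg x1),
      mul_nonneg hnn (sq_nonneg v1)]
  have hvs : p.kva * Real.sin c.xi ≤ p.kvx := by
    nlinarith only [p.kva_lt, Real.sin_le_one c.xi, hkva]
  have hvc : p.kva * Real.sin c.xi ≤ p.kva * cw := mul_le_mul_of_nonneg_left hcw.le hkva.le
  have hgl : 0 < c.gp * lamMaxM p := mul_pos hgp hlM
  have z1 : 0 ≤ (k * p.kpx - k ^ 2 * p.kvx / 2 - c.mu) * x0 ^ 2 :=
    mul_nonneg (by linarith) (sq_nonneg _)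
  have z2 : 0 ≤ ((k * p.kpa - k ^ 2 * p.kva / 2) * cw - p.kpa * (1 - cw) - c.mu) * x1 ^ 2 :=
    mul_nonneg (by linarith) (sq_nonneg _)
  have z3 : 0 ≤ (p.kvx / 2 - c.gp * lamMaxM p - c.gp * c.kc - c.mu) * v0 ^ 2 :=
    mul_nonneg (by linarith) (sq_nonneg _)
  have z4 : 0 ≤ (p.kva * cw / 2 - c.gp * lamMaxM p - c.gp * c.kc - p.kpa * (1 - cw) - c.mu)
      * v1 ^ 2 :=
    mul_nonneg (by linarith) (sq_nonneg _)
  linarith only [z1, z2, z3, z4, y1, y2, y3, hin, hcor]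

/-- The dissipation inequality of input-to-state stability. -/
theorem exists_lyapRate_le (h : Admissible p c) :
    ∃ K > 0, ∀ {qd q v : Fin 2 → ℝ} {w : ℝ}, |w| < thetaMax p c → nrm (qd - q) < qMax c →
      p.lyapRate (crossWeight c) qd q v w
        ≤ -(c.mu / 2) * nrmPair (qd - q) v ^ 2 + K * w ^ 2 := by
  obtain ⟨D, hD, hδ⟩ := p.exists_abs_delta_le
  have hmu := h.mu_pos
  refine ⟨(1 + crossWeight c ^ 2) * D ^ 2 / (2 * c.mu), by positivity,
    fun {qd q v w} hw hq => (h.lyapRate_le hw hq).trans ?_⟩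
  set d := p.delta qd q v w 1
  set k := crossWeight c
  have hd : d ^ 2 ≤ D ^ 2 * w ^ 2 := by
    rw [← mul_pow, ← sq_abs, ← sq_abs (D * w), abs_mul, abs_of_pos hD]
    exact pow_le_pow_left₀ (abs_nonneg _) (hδ qd q v w) 2
  have e1 : (qd - q) 1 = qd 1 - q 1 := rfl
  rw [nrmPair_sq, e1]
  set x1 := qd 1 - q 1
  have y1 : v 1 * d ≤ c.mu / 2 * v 1 ^ 2 + d ^ 2 / (2 * c.mu) := by
    have : 0 ≤ (c.mu * v 1 - d) ^ 2 / (2 * c.mu) := by positivity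
    have e : (c.mu * v 1 - d) ^ 2 / (2 * c.mu)
        = c.mu / 2 * v 1 ^ 2 + d ^ 2 / (2 * c.mu) - v 1 * d := by field_simp; ring
    linarith
  have y2 : -(k * x1 * d) ≤ c.mu / 2 * x1 ^ 2 + k ^ 2 * d ^ 2 / (2 * c.mu) := by
    have : 0 ≤ (c.mu * x1 + k * d) ^ 2 / (2 * c.mu) := by positivity
    have e : (c.mu * x1 + k * d) ^ 2 / (2 * c.mu)
        = c.mu / 2 * x1 ^ 2 + k ^ 2 * d ^ 2 / (2 * c.mu) + k * x1 * d := by field_simp; ring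
    linarith
  have y3 : (1 + k ^ 2) * d ^ 2 / (2 * c.mu) ≤ (1 + k ^ 2) * D ^ 2 / (2 * c.mu) * w ^ 2 := by
    rw [div_mul_eq_mul_div, mul_assoc]
    gcongr
  have y4 : (1 + k ^ 2) * d ^ 2 / (2 * c.mu)
      = d ^ 2 / (2 * c.mu) + k ^ 2 * d ^ 2 / (2 * c.mu) := by ring
  have y5 : 0 ≤ c.mu / 2 * ((qd - q) 0 ^ 2 + v 0 ^ 2) := by positivity
  linarith

/-- The ISS estimate with exponential decay and linear gain, for trajectories starting at an
arbitrary time; the constants do not depend on the desired configuration. -/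
theorem exists_iss_bound (h : Admissible p c) :
    ∃ B > 0, ∃ a > 0, ∃ K > 0, ∀ {qd : Fin 2 → ℝ} {t₀ T : ℝ} {w : ℝ → ℝ} {q v : ℝ → Fin 2 → ℝ},
      p.IsTraj qd (Set.Ico t₀ T) w q v →
      (∀ t ∈ Set.Ico t₀ T, |w t| < thetaMax p c ∧ nrm (qd - q t) < qMax c) →
      ∀ t ∈ Set.Ico t₀ T, ∀ C, 0 ≤ C → (∀ s ∈ Set.Ico t₀ t, |w s| ≤ C) →
        nrmPair (qd - q t) (v t)
          ≤ B * Real.exp (-(a * (t - t₀))) * nrmPair (qd - q t₀) (v t₀) + K * C := by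
  obtain ⟨c₁, hc₁, c₂, hc₂, hV⟩ := p.exists_lyap_bounds h.crossWeight_sq_mul_lt
  obtain ⟨K, hK, hrate⟩ := h.exists_lyapRate_le
  have hmu := h.mu_pos
  set a := c.mu / (2 * c₂) with ha
  have ha0 : 0 < a := by positivity
  refine ⟨Real.sqrt (c₂ / c₁), by positivity, a / 2, by positivity, Real.sqrt (K / (a * c₁)),
    by positivity, fun {qd t₀ T w q v} htr hres t ht C hC hw => ?_⟩
  have hsub : Set.Icc t₀ t ⊆ Set.Ico t₀ T := fun s hs => ⟨hs.1, hs.2.trans_lt ht.2⟩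
  have hcont : ContinuousOn (fun s => p.lyap (crossWeight c) qd (q s) (v s)) (Set.Icc t₀ t) :=
    p.continuousOn_lyap _ (htr.1.mono hsub) (htr.2.1.mono hsub)
  have hG := le_gronwallBound_of_liminf_deriv_right_le (δ := p.lyap (crossWeight c) qd (q t₀) (v t₀))
    (K := -a) (ε := K * C ^ 2) hcont
    (f' := fun s => p.lyapRate (crossWeight c) qd (q s) (v s) (w s))
    (fun s hs r hr => by
      obtain ⟨hq, acc, hv, heq⟩ := htr.2.2 s (hsub ⟨hs.1, hs.2.le⟩)
      exact (p.hasDerivWithinAt_lyap _ hq hv heq).liminf_right_slope_le hr)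
    le_rfl
    (fun s hs => by
      have hs' := hres s (hsub ⟨hs.1, hs.2.le⟩)
      refine (hrate hs'.1 hs'.2).trans ?_
      have h1 : a * p.lyap (crossWeight c) qd (q s) (v s)
          ≤ c.mu / 2 * nrmPair (qd - q s) (v s) ^ 2 := by
        refine (mul_le_mul_of_nonneg_left (hV qd (q s) (v s)).2 ha0.le).trans_eq ?_
        rw [ha]; field_simp
      have h2 : K * w s ^ 2 ≤ K * C ^ 2 := by
        rw [← sq_abs]
        gcongr
        exact hw s hs
      linarith)
    t ⟨ht.1, le_rfl⟩
  rw [gronwallBound_of_K_ne_0 (by linarith)] at hG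
  set E := Real.exp (-(a / 2 * (t - t₀))) with hE
  have hE2 : Real.exp (-a * (t - t₀)) = E ^ 2 := by
    rw [hE, ← Real.exp_nat_mul]; congr 1; push_cast; ring
  simp only [hE2] at hG
  have h1 := (hV qd (q t) (v t)).1
  have h2 := (hV qd (q t₀) (v t₀)).2
  set z := nrmPair (qd - q t) (v t)
  set z₀ := nrmPair (qd - q t₀) (v t₀)
  have hz₀ : 0 ≤ z₀ := nrmPair_nonneg _ _
  have hE0 : 0 < E := Real.exp_pos _
  have h3 : c₁ * z ^ 2 ≤ c₂ * z₀ ^ 2 * E ^ 2 + K * C ^ 2 / a := by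
    have e : K * C ^ 2 / -a * (E ^ 2 - 1) = K * C ^ 2 / a - K * C ^ 2 / a * E ^ 2 := by
      field_simp; ring
    have : 0 ≤ K * C ^ 2 / a * E ^ 2 := by positivity
    have := mul_le_mul_of_nonneg_right h2 (sq_nonneg E)
    linarith
  have hX : 0 ≤ Real.sqrt (c₂ / c₁) * E * z₀ := by positivity
  have hY : 0 ≤ Real.sqrt (K / (a * c₁)) * C := by positivity
  refine abs_le_of_sq_le_sq' ?_ (add_nonneg hX hY) |>.2
  have h4 : z ^ 2 ≤ (Real.sqrt (c₂ / c₁) * E * z₀) ^ 2 + (Real.sqrt (K / (a * c₁)) * C) ^ 2 := by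
    rw [mul_pow, mul_pow, mul_pow, Real.sq_sqrt (by positivity), Real.sq_sqrt (by positivity)]
    have : z ^ 2 ≤ (c₂ * z₀ ^ 2 * E ^ 2 + K * C ^ 2 / a) / c₁ := by
      rw [le_div_iff₀ hc₁]; linarith
    refine this.trans_eq ?_
    field_simp
  nlinarith [mul_nonneg hX hY]

end Admissible

/-! ### The ISS estimate -/

theorem Params.IsTraj.mono {p : Params} {qd : Fin 2 → ℝ} {I J : Set ℝ} {w : ℝ → ℝ}
    {q v : ℝ → Fin 2 → ℝ} (h : p.IsTraj qd I w q v) (hJ : J ⊆ I) : p.IsTraj qd J w q v :=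
  ⟨h.1.mono hJ, h.2.1.mono hJ, fun t ht => h.2.2 t (hJ ht)⟩

theorem isClassK_const_mul {K : ℝ} (hK : 0 < K) : IsClassK fun r => K * r :=
  ⟨mul_zero K, by fun_prop, fun _ _ _ _ h => mul_lt_mul_of_pos_left h hK⟩

theorem isClassKL_exp {B a : ℝ} (hB : 0 < B) (ha : 0 < a) :
    IsClassKL fun r t => B * Real.exp (-(a * t)) * r := by
  refine ⟨Continuous.continuousOn ?_, fun t _ => isClassK_const_mul (by positivity),
    fun r hr => ⟨fun s _ t _ hst => ?_, ?_⟩⟩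
  · unfold Function.uncurry
    fun_prop
  · have : Real.exp (-(a * t)) ≤ Real.exp (-(a * s)) := by
      gcongr
    exact mul_le_mul_of_nonneg_right (mul_le_mul_of_nonneg_left this hB.le) hr
  · have h1 : Tendsto (fun t : ℝ => Real.exp (-(a * t))) atTop (𝓝 0) :=
      Real.tendsto_exp_neg_atTop_nhds_zero.comp (tendsto_id.const_mul_atTop ha)
    simpa using (h1.const_mul B).mul_const r

namespace Admissible

variable {p : Params} {c : Consts}

theorem exists_iss_estimate (h : Admissible p c) (qd : Fin 2 → ℝ) :
    ∃ (b : ℝ → ℝ → ℝ) (k : ℝ → ℝ), IsClassKL b ∧ IsClassK k ∧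
      ∀ (T : ℝ) (w : ℝ → ℝ) (q v : ℝ → Fin 2 → ℝ), p.IsTraj qd (Set.Ico 0 T) w q v →
        (∀ t ∈ Set.Ico 0 T, |w t| < thetaMax p c ∧ nrm (qd - q t) < qMax c) →
        ∀ t ∈ Set.Ico 0 T, nrmPair (qd - q t) (v t) ≤
          b (nrmPair (qd - q 0) (v 0)) t + k (sSup ((fun s => |w s|) '' Set.Icc 0 t)) := by
  obtain ⟨B, hB, a, ha, K, hK, hest⟩ := h.exists_iss_bound
  refine ⟨_, _, isClassKL_exp hB ha, isClassK_const_mul hK, fun T w q v htr hres t ht => ?_⟩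
  have hbdd : BddAbove ((fun s => |w s|) '' Set.Icc 0 t) := by
    refine ⟨thetaMax p c, ?_⟩
    rintro _ ⟨s, hs, rfl⟩
    exact (hres s ⟨hs.1, hs.2.trans_lt ht.2⟩).1.le
  have hle : ∀ s ∈ Set.Icc 0 t, |w s| ≤ sSup ((fun s => |w s|) '' Set.Icc 0 t) :=
    fun s hs => le_csSup hbdd ⟨s, hs, rfl⟩
  have := hest htr hres t ht _ ((abs_nonneg _).trans (hle 0 ⟨le_rfl, ht.1⟩))
    (fun s hs => hle s ⟨hs.1, hs.2.le⟩)
  simpa using this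

/-- Before the first time at which the restriction on the position error could fail, the ISS
estimate keeps the error below half of the bound. -/
theorem exists_small_nrm_lt (h : Admissible p c) (qd : Fin 2 → ℝ) :
    ∃ r > 0, ∃ d > 0, ∀ (T : ℝ) (w : ℝ → ℝ) (q v : ℝ → Fin 2 → ℝ),
      p.IsTraj qd (Set.Ico 0 T) w q v → nrmPair (qd - q 0) (v 0) < r →
      (∀ t ∈ Set.Ico 0 T, |w t| < d) → ∀ t ∈ Set.Ico 0 T, nrm (qd - q t) < qMax c := by
  obtain ⟨B, hB, a, ha, K, hK, hest⟩ := h.exists_iss_bound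
  have hQ := h.qMax_pos
  have hW := h.thetaMax_pos
  refine ⟨min (qMax c) (qMax c / (4 * B)), by positivity, min (thetaMax p c) (qMax c / (4 * K)),
    lt_min hW (by positivity), fun T w q v htr h0 hw t ht => ?_⟩
  by_contra hcon
  push Not at hcon
  have hc : ContinuousOn (fun s => nrm (qd - q s)) (Set.Icc 0 t) :=
    continuous_nrm.comp_continuousOn
      (continuousOn_const.sub (htr.1.mono fun s hs => ⟨hs.1, hs.2.trans_lt ht.2⟩))
  -- the first time `t₁` at which the bound is violated
  set S := {s ∈ Set.Icc 0 t | qMax c ≤ nrm (qd - q s)} with hS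
  have hSc : IsCompact S :=
    isCompact_Icc.of_isClosed_subset
      (hc.preimage_isClosed_of_isClosed isClosed_Icc isClosed_Ici) fun s hs => hs.1
  obtain ⟨t₁, ⟨ht₁, hq₁⟩, hmin⟩ := hSc.exists_isLeast ⟨t, ⟨ht.1, le_rfl⟩, hcon⟩
  have ht₁T : t₁ < T := ht₁.2.trans_lt ht.2
  have hsub : Set.Ico 0 t₁ ⊆ Set.Ico 0 T := Set.Ico_subset_Ico_right ht₁T.le
  have hpos : 0 < t₁ := by
    refine ht₁.1.lt_of_ne fun h1 => ?_
    rw [← h1] at hq₁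
    have := nrm_le_nrmPair (qd - q 0) (v 0)
    linarith [min_le_left (qMax c) (qMax c / (4 * B))]
  have hbefore : ∀ s ∈ Set.Ico 0 t₁, nrm (qd - q s) ≤ qMax c / 2 := by
    intro s hs
    have h1 := hest (htr.mono hsub) (fun u hu => ⟨(hw u (hsub hu)).trans_le (min_le_left _ _),
      not_le.1 fun h2 => (hmin ⟨⟨hu.1, hu.2.le.trans ht₁.2⟩, h2⟩).not_gt hu.2⟩) s hs
      (qMax c / (4 * K)) (by positivity)
      (fun u hu => ((hw u (hsub ⟨hu.1, hu.2.trans hs.2⟩)).trans_le (min_le_right _ _)).le)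
    have h2 : Real.exp (-(a * (s - 0))) ≤ 1 :=
      Real.exp_le_one_iff.2 (neg_nonpos.2 (mul_nonneg ha.le (sub_nonneg.2 hs.1)))
    have h3 : B * Real.exp (-(a * (s - 0))) * nrmPair (qd - q 0) (v 0)
        ≤ B * 1 * (qMax c / (4 * B)) := by
      gcongr
      · exact nrmPair_nonneg _ _
      · exact (h0.trans_le (min_le_right _ _)).le
    have h4 : B * 1 * (qMax c / (4 * B)) = qMax c / 4 := by field_simp
    have h5 : K * (qMax c / (4 * K)) = qMax c / 4 := by field_simp
    linarith [nrm_le_nrmPair (qd - q s) (v s)]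
  have hcl : nrm (qd - q t₁) ≤ qMax c / 2 := by
    have h1 : ContinuousWithinAt (fun s => nrm (qd - q s)) (Set.Ico 0 t₁) t₁ :=
      (hc t₁ ht₁).mono fun s hs => ⟨hs.1, hs.2.le.trans ht₁.2⟩
    refine h1.closure_le ?_ continuousWithinAt_const hbefore
    rw [closure_Ico hpos.ne]
    exact ⟨hpos.le, le_rfl⟩
  linarith

end Admissible

/-! ### The rate of the desired attitude and the asymptotic gain -/

/-- Truncation preserves right differentiability, also at the corner. -/
theorem exists_hasDerivWithinAt_max (l : ℝ) {y : ℝ → ℝ} {y' t : ℝ}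
    (hy : HasDerivWithinAt y y' (Set.Ici t) t) :
    ∃ d, |d| ≤ |y'| ∧ HasDerivWithinAt (fun s => max l (y s)) d (Set.Ici t) t := by
  have hc := hy.continuousWithinAt
  rcases lt_trichotomy (y t) l with h | h | h
  · refine ⟨0, by simp, (hasDerivWithinAt_const t _ l).congr_of_eventuallyEq ?_ (max_eq_left h.le)⟩
    filter_upwards [hc.eventually_lt_const h] with s hs using max_eq_left hs.le
  · -- on the boundary the difference quotient is the positive part of that of `y`
    refine ⟨max 0 y', ?_, ?_⟩
    · rcases le_total y' 0 with h' | h' <;> simp [h']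
    · have hs := hasDerivWithinAt_iff_tendsto_slope.1 hy
      refine hasDerivWithinAt_iff_tendsto_slope.2
        (((tendsto_const_nhds (x := (0 : ℝ))).max hs).congr' ?_)
      filter_upwards [self_mem_nhdsWithin] with s hs
      have hst : 0 < s - t := sub_pos.2 (lt_of_le_of_ne hs.1 (Ne.symm hs.2))
      rw [slope_def_field, slope_def_field, ← h, max_self, ← max_sub_sub_right, sub_self,
        ← max_div_div_right hst.le, zero_div]
  · refine ⟨y', le_rfl, hy.congr_of_eventuallyEq ?_ (max_eq_right h.le)⟩
    filter_upwards [hc.eventually_const_lt h] with s hs using max_eq_right hs.le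

theorem exists_hasDerivWithinAt_min (l : ℝ) {y : ℝ → ℝ} {y' t : ℝ}
    (hy : HasDerivWithinAt y y' (Set.Ici t) t) :
    ∃ d, |d| ≤ |y'| ∧ HasDerivWithinAt (fun s => min l (y s)) d (Set.Ici t) t := by
  obtain ⟨d, hd, h⟩ := exists_hasDerivWithinAt_max (-l) hy.neg
  refine ⟨-d, by simpa using hd, h.neg.congr_of_eventuallyEq (.of_forall fun s => ?_) ?_⟩ <;>
    simp [max_neg_neg]

namespace Params

variable (p : Params)

theorem exists_hasDerivWithinAt_thetaD {f : ℝ → ℝ} {f' t : ℝ}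
    (hf : HasDerivWithinAt f f' (Set.Ici t) t) :
    ∃ d, |d| ≤ p.gam * p.eps * |f'| ∧
      HasDerivWithinAt (fun s => p.thetaD (f s)) d (Set.Ici t) t := by
  obtain ⟨d₁, hd₁, h₁⟩ := exists_hasDerivWithinAt_min (p.Tmax * p.L) hf
  obtain ⟨d₂, hd₂, h₂⟩ := exists_hasDerivWithinAt_max (-(p.Tmax * p.L)) h₁
  have h₃ := (p.hasDerivAt_rawTheta (p.clampForce (f t))).comp_hasDerivWithinAt t h₂
  refine ⟨_, ?_, h₃.congr_of_eventuallyEq (.of_forall fun s => p.thetaD_eq (f s))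
    (p.thetaD_eq (f t))⟩
  have hg := p.gam_pos
  have he := p.eps_pos
  have h4 : 1 / (1 + (p.eps * p.clampForce (f t)) ^ 2) ≤ 1 :=
    div_le_one_of_le₀ (by nlinarith [sq_nonneg (p.eps * p.clampForce (f t))]) (by positivity)
  rw [abs_mul, abs_of_nonneg (by positivity)]
  calc p.gam * (1 / (1 + (p.eps * p.clampForce (f t)) ^ 2) * p.eps) * |d₂|
      ≤ p.gam * (1 * p.eps) * |f'| := by
        have h5 := hd₂.trans hd₁
        gcongr
    _ = p.gam * p.eps * |f'| := by ring

theorem abs_coord_le_nrmPair (e v : Fin 2 → ℝ) :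
    |e 0| ≤ nrmPair e v ∧ |e 1| ≤ nrmPair e v ∧ |v 0| ≤ nrmPair e v ∧ |v 1| ≤ nrmPair e v := by
  have h := nrmPair_sq e v
  have h0 := nrmPair_nonneg e v
  refine ⟨?_, ?_, ?_, ?_⟩ <;> refine abs_le_of_sq_le_sq ?_ h0 <;> rw [h] <;> nlinarith
    [sq_nonneg (e 0), sq_nonneg (e 1), sq_nonneg (v 0), sq_nonneg (v 1)]

/-- The angular acceleration is bounded in terms of state and input; the quadratic term stems from
the Coriolis force. -/
theorem exists_abs_acc_le : ∃ A > 0, ∀ (qd q v a : Fin 2 → ℝ) (w : ℝ),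
    p.M q *ᵥ a + p.C q v *ᵥ v + p.grav q = p.tau qd q v w →
      |a 1| ≤ A * (nrmPair (qd - q) v + nrmPair (qd - q) v ^ 2 + |w|) := by
  obtain ⟨D, hD, hδ⟩ := p.exists_abs_delta_le
  have hm := p.MaL_pos
  have hA := p.Mt_pos
  have hkpx := p.kpx_pos
  have hkvx := p.kvx_pos
  have hkpa := p.kpa_pos
  have hkva := p.kva_pos
  set m := p.Ma * p.L with hmdef
  set d := p.Mt * (p.I0 * p.L) - m ^ 2 with hd
  have hd0 : 0 < d := sub_pos.2 p.sq_MaL_lt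
  refine ⟨(m * (p.kpx + p.kvx + m) + p.Mt * (p.kpa + p.kva + D)) / d, by positivity,
    fun qd q v a w h => ?_⟩
  obtain ⟨h0, h1⟩ := (p.motion_iff qd q v a w).1 h
  obtain ⟨b0, b1, b2, b3⟩ := abs_coord_le_nrmPair (qd - q) v
  rw [show (qd - q) 0 = qd 0 - q 0 from rfl] at b0
  rw [show (qd - q) 1 = qd 1 - q 1 from rfl] at b1
  have hz := nrmPair_nonneg (qd - q) v
  set z := nrmPair (qd - q) v
  set s := Real.sin (q 1)
  set e0 := qd 0 - q 0
  set e1 := qd 1 - q 1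
  have hs : |s| ≤ 1 := Real.abs_sin_le_one _
  have hco : |Real.cos (q 1)| ≤ 1 := Real.abs_cos_le_one _
  have hcw : |Real.cos w| ≤ 1 := Real.abs_cos_le_one _
  set r0 := p.kpx * e0 - p.kvx * v 0 + m * Real.cos (q 1) * v 1 ^ 2 with hr0
  set r1 := p.kpa * Real.cos w * e1 - p.kva * Real.cos w * v 1 + p.delta qd q v w 1 with hr1
  have hsol : (p.Mt * (p.I0 * p.L) - (m * s) ^ 2) * a 1 = m * s * r0 + p.Mt * r1 := by
    linear_combination m * s * h0 + p.Mt * h1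
  have hr0b : |r0| ≤ (p.kpx + p.kvx) * z + m * z ^ 2 := by
    have hv : v 1 ^ 2 ≤ z ^ 2 := by rw [← sq_abs]; gcongr
    calc |r0| ≤ |p.kpx * e0| + |p.kvx * v 0| + |m * Real.cos (q 1) * v 1 ^ 2| :=
          (abs_add_le _ _).trans (add_le_add_left (abs_sub _ _) _)
      _ = p.kpx * |e0| + p.kvx * |v 0| + m * |Real.cos (q 1)| * v 1 ^ 2 := by
          rw [abs_mul, abs_mul, abs_mul, abs_mul, abs_of_pos hkpx, abs_of_pos hkvx, abs_of_pos hm,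
            abs_of_nonneg (sq_nonneg (v 1))]
      _ ≤ p.kpx * z + p.kvx * z + m * 1 * z ^ 2 := by gcongr
      _ = _ := by ring
  have hr1b : |r1| ≤ (p.kpa + p.kva) * z + D * |w| := by
    calc |r1| ≤ |p.kpa * Real.cos w * e1| + |p.kva * Real.cos w * v 1| + |p.delta qd q v w 1| :=
          (abs_add_le _ _).trans (add_le_add_left (abs_sub _ _) _)
      _ = p.kpa * |Real.cos w| * |e1| + p.kva * |Real.cos w| * |v 1| + |p.delta qd q v w 1| := by
          rw [abs_mul, abs_mul, abs_mul, abs_mul, abs_of_pos hkpa, abs_of_pos hkva]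
      _ ≤ p.kpa * 1 * z + p.kva * 1 * z + D * |w| := by
          gcongr
          exact hδ qd q v w
      _ = _ := by ring
  have hdet : d ≤ p.Mt * (p.I0 * p.L) - (m * s) ^ 2 := by
    linarith [p.sq_MaL_sin_le (q 1)]
  rw [div_mul_eq_mul_div, le_div_iff₀ hd0]
  calc |a 1| * d ≤ |a 1| * (p.Mt * (p.I0 * p.L) - (m * s) ^ 2) := by gcongr
    _ = |m * s * r0 + p.Mt * r1| := by
        rw [← hsol, abs_mul, abs_of_pos (hd0.trans_le hdet), mul_comm]
    _ ≤ m * |s| * |r0| + p.Mt * |r1| := by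
        refine (abs_add_le _ _).trans_eq ?_
        rw [abs_mul (m * s), abs_mul m, abs_mul p.Mt, abs_of_pos hm, abs_of_pos hA]
    _ ≤ m * 1 * ((p.kpx + p.kvx) * z + m * z ^ 2) + p.Mt * ((p.kpa + p.kva) * z + D * |w|) := by
        gcongr
    _ ≤ (m * (p.kpx + p.kvx + m) + p.Mt * (p.kpa + p.kva + D)) * (z + z ^ 2 + |w|) := by
        have n1 : 0 ≤ m * (p.kpx + p.kvx) * (z ^ 2 + |w|) := by positivity
        have n2 : 0 ≤ m * m * (z + |w|) := by positivity
        have n3 : 0 ≤ p.Mt * (p.kpa + p.kva) * (z ^ 2 + |w|) := by positivity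
        have n4 : 0 ≤ p.Mt * D * (z + z ^ 2) := by positivity
        linarith

/-- `β_d` is right differentiable along trajectories, with rate controlled by state and input. -/
theorem exists_hasDerivWithinAt_betaD : ∃ A > 0, ∀ {qd : Fin 2 → ℝ} {I : Set ℝ} {w : ℝ → ℝ}
    {q v : ℝ → Fin 2 → ℝ}, p.IsTraj qd I w q v → ∀ t ∈ I, ∃ d,
      HasDerivWithinAt (fun s => p.betaD qd (q s) (v s)) d (Set.Ici t) t ∧
      |d| ≤ A * (nrmPair (qd - q t) (v t) + nrmPair (qd - q t) (v t) ^ 2 + |w t|) := by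
  obtain ⟨A, hA, hacc⟩ := p.exists_abs_acc_le
  have hkpa := p.kpa_pos
  have hkva := p.kva_pos
  have hm := mul_pos p.MaL_pos p.g_pos
  have hge := mul_pos p.gam_pos p.eps_pos
  refine ⟨p.gam * p.eps * (p.kpa + p.kva * A + p.Ma * p.L * p.g) + 1, by positivity,
    fun {qd I w q v} htr t ht => ?_⟩
  obtain ⟨hq, a, hv, heq⟩ := htr.2.2 t ht
  have q1 := hasDerivWithinAt_pi.1 hq 1
  have v1 := hasDerivWithinAt_pi.1 hv 1
  have hf : HasDerivWithinAt (fun s => p.ft qd (q s) (v s))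
      (p.kpa * (-v t 1) - p.kva * a 1 + p.Ma * p.L * p.g * (-Real.sin (q t 1) * v t 1))
      (Set.Ici t) t :=
    (((q1.const_sub (qd 1)).const_mul p.kpa).sub (v1.const_mul p.kva)).add
      (q1.cos.const_mul (p.Ma * p.L * p.g))
  obtain ⟨d, hd, hθ⟩ := p.exists_hasDerivWithinAt_thetaD hf
  refine ⟨d + v t 1, hθ.add q1, ?_⟩
  have ha := hacc qd (q t) (v t) a (w t) heq
  have hv1 := (abs_coord_le_nrmPair (qd - q t) (v t)).2.2.2
  have hz := nrmPair_nonneg (qd - q t) (v t)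
  set z := nrmPair (qd - q t) (v t)
  set u := z + z ^ 2 + |w t| with hu
  have hzu : z ≤ u := by rw [hu]; linarith [sq_nonneg z, abs_nonneg (w t)]
  have hsin := Real.abs_sin_le_one (q t 1)
  have hv1u := hv1.trans hzu
  have hu0 := hz.trans hzu
  have hfb : |p.kpa * (-v t 1) - p.kva * a 1 + p.Ma * p.L * p.g * (-Real.sin (q t 1) * v t 1)|
      ≤ p.kpa * u + p.kva * (A * u) + p.Ma * p.L * p.g * (1 * u) := by
    refine (abs_add_le _ _).trans (add_le_add ((abs_sub _ _).trans (add_le_add ?_ ?_)) ?_)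
    · rw [abs_mul, abs_neg, abs_of_pos hkpa]; gcongr
    · rw [abs_mul, abs_of_pos hkva]; gcongr
    · rw [abs_mul, abs_of_pos hm, abs_mul, abs_neg]; gcongr
  calc |d + v t 1| ≤ |d| + |v t 1| := abs_add_le _ _
    _ ≤ p.gam * p.eps * (p.kpa * u + p.kva * (A * u) + p.Ma * p.L * p.g * (1 * u)) + u :=
        add_le_add (hd.trans (mul_le_mul_of_nonneg_left hfb hge.le)) hv1u
    _ = _ := by ring

end Params

/-- The asymptotic gain: a trajectory restarted at a late time obeys the ISS estimate with the
asymptotic bound on the input, and the rate of `β_d` is linearly bounded in state and input once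
the state is bounded. -/
theorem Admissible.exists_asymptoticGain {p : Params} {c : Consts} (h : Admissible p c) :
    ∃ G : ℝ, 0 ≤ G ∧ ∀ qd, HasAsymptoticGain p qd (thetaMax p c) (qMax c) G := by
  obtain ⟨B, hB, a, ha, K, hK, hest⟩ := h.exists_iss_bound
  obtain ⟨A, hA, hder⟩ := p.exists_hasDerivWithinAt_betaD
  have hW := h.thetaMax_pos
  set W := thetaMax p c
  refine ⟨A * ((K * W + 2) * K + 1), by positivity, fun qd w q v htr hres =>
    ⟨fun t ht => (hder htr t ht).choose_spec.1.differentiableWithinAt, fun C hC C' hC' => ?_⟩⟩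
  obtain ⟨t₁, ht₁⟩ := eventually_atTop.1 hC
  set t₀ := max t₁ 0
  have ht₀ : 0 ≤ t₀ := le_max_right _ _
  have hC0 : 0 ≤ C := (abs_nonneg _).trans (ht₁ t₁ le_rfl)
  set η := min 1 ((C' - A * ((K * W + 2) * K + 1) * C) / (A * (K * W + 2))) with hη
  have hη0 : 0 < η := lt_min one_pos (div_pos (sub_pos.2 hC') (by positivity))
  have hη1 : η ≤ 1 := min_le_left _ _
  have hη2 : A * (K * W + 2) * η ≤ C' - A * ((K * W + 2) * K + 1) * C := by
    have h1 := min_le_right 1 ((C' - A * ((K * W + 2) * K + 1) * C) / (A * (K * W + 2)))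
    rw [← hη, le_div_iff₀ (by positivity)] at h1
    linarith
  have hlim : Tendsto (fun t => B * Real.exp (-(a * (t - t₀))) * nrmPair (qd - q t₀) (v t₀))
      atTop (𝓝 0) := by
    have h1 : Tendsto (fun t : ℝ => Real.exp (-(a * (t - t₀)))) atTop (𝓝 0) :=
      Real.tendsto_exp_neg_atTop_nhds_zero.comp
        ((tendsto_atTop_add_const_right _ (-t₀) tendsto_id).const_mul_atTop ha)
    simpa using (h1.const_mul B).mul_const (nrmPair (qd - q t₀) (v t₀))
  filter_upwards [hlim.eventually_lt_const hη0, eventually_ge_atTop t₀] with t ht htt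
  have hsub : Set.Ico t₀ (t + 1) ⊆ Set.Ici 0 := fun s hs => ht₀.trans hs.1
  have hwC : ∀ s, t₀ ≤ s → |w s| ≤ min C W := fun s hs =>
    le_min (ht₁ s ((le_max_left _ _).trans hs)) (hres s (ht₀.trans hs)).1.le
  have hz := hest (htr.mono hsub) (fun s hs => hres s (hsub hs)) t ⟨htt, lt_add_one t⟩
    (min C W) (le_min hC0 hW.le) (fun s hs => hwC s hs.1)
  obtain ⟨d, hd, hdb⟩ := hder htr t (ht₀.trans htt)
  rw [hd.derivWithin (uniqueDiffOn_Ici t t Set.self_mem_Ici)]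
  have hz0 := nrmPair_nonneg (qd - q t) (v t)
  set z := nrmPair (qd - q t) (v t)
  have hmC : K * min C W ≤ K * C := mul_le_mul_of_nonneg_left (min_le_left _ _) hK.le
  have hmW : K * min C W ≤ K * W := mul_le_mul_of_nonneg_left (min_le_right _ _) hK.le
  have hz1 : z ≤ K * C + η := by linarith
  have hz2 : z ≤ K * W + 1 := by linarith
  have hwt : |w t| ≤ C := (hwC t htt).trans (min_le_left _ _)
  calc |d| ≤ A * (z + z ^ 2 + |w t|) := hdb
    _ ≤ A * ((K * W + 2) * (K * C + η) + C) := by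
        have : z + z ^ 2 ≤ (K * W + 2) * (K * C + η) := by
          calc z + z ^ 2 ≤ (K * W + 2) * z := by nlinarith
            _ ≤ _ := by gcongr
        gcongr
    _ ≤ C' := by linarith

/-! ### Existence of admissible constants -/

theorem Params.nrm_C_mulVec_le (p : Params) (q v : Fin 2 → ℝ) :
    nrm (p.C q v *ᵥ v) ≤ p.Ma * p.L * nrm v ^ 2 := by
  have hm := p.MaL_pos
  refine abs_le_of_sq_le_sq' ?_ (by positivity) |>.2
  have e0 : (p.C q v *ᵥ v) 0 = -(p.Ma * p.L * v 1 * Real.cos (q 1)) * v 1 := by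
    simp [Params.C, mulVec, dotProduct, Fin.sum_univ_two]
  have e1 : (p.C q v *ᵥ v) 1 = 0 := by
    simp [Params.C, mulVec, dotProduct, Fin.sum_univ_two]
  rw [nrm_sq, nrm_sq, e0, e1]
  have h1 : Real.cos (q 1) ^ 2 ≤ 1 := Real.cos_sq_le_one _
  have h2 : (v 1 ^ 2) ^ 2 ≤ (v 0 ^ 2 + v 1 ^ 2) ^ 2 := by
    gcongr
    linarith [sq_nonneg (v 0)]
  calc (-(p.Ma * p.L * v 1 * Real.cos (q 1)) * v 1) ^ 2 + 0 ^ 2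
      = (p.Ma * p.L) ^ 2 * (v 1 ^ 2) ^ 2 * Real.cos (q 1) ^ 2 := by ring
    _ ≤ (p.Ma * p.L) ^ 2 * (v 0 ^ 2 + v 1 ^ 2) ^ 2 * 1 := by gcongr
    _ = _ := by ring

theorem exists_admissible (p : Params) : ∃ c : Consts, Admissible p c := by
  have hpi := Real.pi_pos
  have hkpa := p.kpa_pos
  have hkva := p.kva_pos
  have hkpx := p.kpx_pos
  have hkvx := p.kvx_pos
  have hlM := p.lamMaxM_pos
  have hm := p.MaL_pos
  have hs : 0 < Real.sin (Real.pi / 4) :=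
    Real.sin_pos_of_pos_of_lt_pi (by positivity) (by linarith)
  have hs1 := Real.sin_le_one (Real.pi / 4)
  set s := Real.sin (Real.pi / 4)
  -- with `ξ = π / 4` and `kc = Ma L`, each remaining constant lies in a nonempty interval
  obtain ⟨g, hg0, hg⟩ := exists_between (a₁ := (0 : ℝ))
    (a₂ := min (min (Real.sqrt (p.kpa / lamMaxM p)) (2 * (p.kpa * s) / p.kvx))
      (p.kva * s / (2 * (p.Ma * p.L + 2 * lamMaxM p))))
    (lt_min (lt_min (by positivity) (by positivity)) (by positivity))
  have hg1 : g < 2 * (p.kpa * s) / p.kvx :=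
    hg.trans_le ((min_le_left _ _).trans (min_le_right _ _))
  have hg2 : g < p.kva * s / (2 * (p.Ma * p.L + 2 * lamMaxM p)) := hg.trans_le (min_le_right _ _)
  rw [lt_div_iff₀ (by positivity)] at hg1 hg2
  have hgx : g * p.kvx < 2 * p.kpa := hg1.trans_le (by nlinarith)
  have h1 : 0 < p.kva * s / 2 - 2 * g * lamMaxM p - g * (p.Ma * p.L) := by linarith
  have h2 : 0 < g * p.kpx - g ^ 2 * p.kvx / 2 := by
    have : 0 < g * (2 * p.kpx - g * p.kvx) := mul_pos hg0 (by linarith [p.kpa_lt])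
    linarith
  have h3 : 0 < g * p.kpa - g ^ 2 * p.kva / 2 := by
    have : 0 < g * (2 * p.kpa - g * p.kva) :=
      mul_pos hg0 (by linarith [mul_lt_mul_of_pos_left p.kva_lt hg0])
    linarith
  obtain ⟨mu, hmu0, hmu⟩ := exists_between (lt_min (lt_min h1 h2) h3)
  have hmu2 : mu < g * p.kpx - g ^ 2 * p.kvx / 2 :=
    hmu.trans_le ((min_le_left _ _).trans (min_le_right _ _))
  have hmu3 : mu < g * p.kpa - g ^ 2 * p.kva / 2 := hmu.trans_le (min_le_right _ _)
  obtain ⟨q1, hq1, hq1'⟩ := exists_between (a₁ := (0 : ℝ))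
    (a₂ := 2 * g * p.kpx / (2 * mu + g ^ 2 * p.kvx) - 1) (by
      rw [sub_pos, one_lt_div (by positivity)]; linarith)
  obtain ⟨q2, hq2, hq2'⟩ := exists_between (a₁ := (0 : ℝ))
    (a₂ := 2 * g * p.kpa / (2 * mu + g ^ 2 * p.kva) - 1) (by
      rw [sub_pos, one_lt_div (by positivity)]; linarith)
  exact ⟨⟨Real.pi / 4, p.Ma * p.L, g, mu, q1, q2⟩, by positivity, by dsimp only; linarith, hm,
    p.nrm_C_mulVec_le, hg0, hg, hmu0, hmu, hq1, hq1', hq2, hq2'⟩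

/-! ### Global solutions of non-autonomous equations -/

/-- A non-autonomous differential equation whose right-hand side is, on every bounded time
interval, bounded and uniformly Lipschitz in the state has a solution for all positive times. -/
theorem exists_global_solution {E : Type*} [NormedAddCommGroup E] [NormedSpace ℝ E]
    [CompleteSpace E] {F : ℝ → E → E} (x₀ : E)
    (hlip : ∀ n : ℕ, ∃ K : NNReal, ∀ t ∈ Set.Icc (0 : ℝ) n, LipschitzWith K (F t))
    (hbdd : ∀ n : ℕ, ∃ L : NNReal, ∀ t ∈ Set.Icc (0 : ℝ) n, ∀ x, ‖F t x‖ ≤ L)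
    (hcont : ∀ x, Continuous fun t => F t x) :
    ∃ z : ℝ → E, z 0 = x₀ ∧ ContinuousOn z (Set.Ici 0) ∧
      ∀ t, 0 ≤ t → HasDerivWithinAt z (F t (z t)) (Set.Ici t) t := by
  have hloc : ∀ n : ℕ, ∃ z : ℝ → E, z 0 = x₀ ∧ ∀ t ∈ Set.Icc (0 : ℝ) n,
      HasDerivWithinAt z (F t (z t)) (Set.Icc (0 : ℝ) n) t := by
    intro n
    obtain ⟨K, hK⟩ := hlip n
    obtain ⟨L, hL⟩ := hbdd n
    have hPL : IsPicardLindelof F (tmin := 0) (tmax := n) ⟨0, le_rfl, n.cast_nonneg⟩ x₀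
        (L * n) 0 L K :=
      { lipschitzOnWith := fun t ht => (hK t ht).lipschitzOnWith
        continuousOn := fun x _ => (hcont x).continuousOn
        norm_le := fun t ht x _ => hL t ht x
        mul_max_le := by simp }
    exact hPL.exists_eq_forall_mem_Icc_hasDerivWithinAt₀
  choose z hz0 hz using hloc
  have hright : ∀ n : ℕ, ∀ t ∈ Set.Ico (0 : ℝ) n,
      HasDerivWithinAt (z n) (F t (z n t)) (Set.Ici t) t := fun n t ht =>
    (hz n t ⟨ht.1, ht.2.le⟩).mono_of_mem_nhdsWithin
      (mem_of_superset (Icc_mem_nhdsGE ht.2) (Set.Icc_subset_Icc_left ht.1))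
  have hcz : ∀ n : ℕ, ContinuousOn (z n) (Set.Icc (0 : ℝ) n) := fun n t ht =>
    (hz n t ht).continuousWithinAt
  have huniq : ∀ n m : ℕ, n ≤ m → Set.EqOn (z n) (z m) (Set.Icc (0 : ℝ) n) := by
    intro n m hnm
    have hnm' : (n : ℝ) ≤ m := Nat.cast_le.2 hnm
    obtain ⟨K, hK⟩ := hlip n
    exact ODE_solution_unique_of_mem_Icc_right (s := fun _ => Set.univ) (K := K)
      (fun t ht => (hK t ⟨ht.1, ht.2.le⟩).lipschitzOnWith)
      (hcz n) (hright n) (fun _ _ => trivial)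
      ((hcz m).mono (Set.Icc_subset_Icc_right hnm'))
      (fun t ht => hright m t ⟨ht.1, ht.2.trans_le hnm'⟩) (fun _ _ => trivial)
      ((hz0 n).trans (hz0 m).symm)
  have hagree : ∀ n : ℕ, ∀ t ∈ Set.Icc (0 : ℝ) n, z (⌈t⌉₊ + 1) t = z n t := by
    intro n t ht
    have h1 : t ≤ ((⌈t⌉₊ + 1 : ℕ) : ℝ) := by push_cast; linarith [Nat.le_ceil t]
    rcases le_total (⌈t⌉₊ + 1) n with h | h
    · exact huniq _ _ h ⟨ht.1, h1⟩
    · exact (huniq _ _ h ht).symm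
  refine ⟨fun t => z (⌈t⌉₊ + 1) t, hz0 _, fun t ht => ?_, fun t ht => ?_⟩
  · obtain ⟨n, hn⟩ := exists_nat_gt t
    have h1 : ContinuousWithinAt (z n) (Set.Ici 0) t :=
      (hcz n t ⟨ht, hn.le⟩).mono_of_mem_nhdsWithin
        (inter_mem_nhdsWithin _ (Iic_mem_nhds hn))
    refine h1.congr_of_eventuallyEq ?_ (hagree n t ⟨ht, hn.le⟩)
    filter_upwards [inter_mem_nhdsWithin (Set.Ici 0) (Iic_mem_nhds hn)] with s hs
    exact hagree n s hs
  · obtain ⟨n, hn⟩ := exists_nat_gt t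
    dsimp only
    rw [hagree n t ⟨ht, hn.le⟩]
    refine (hright n t ⟨ht, hn⟩).congr_of_eventuallyEq ?_ (hagree n t ⟨ht, hn.le⟩)
    filter_upwards [Icc_mem_nhdsGE hn] with s hs
    exact hagree n s ⟨ht.trans hs.1, hs.2⟩

/-- Coordinatewise truncation of the state to `[-R, R]`. -/
def truncate (R : ℝ) (x : (Fin 2 → ℝ) × (Fin 2 → ℝ)) : (Fin 2 → ℝ) × (Fin 2 → ℝ) :=
  (fun i => max (-R) (min R (x.1 i)), fun i => max (-R) (min R (x.2 i)))

theorem lipschitzWith_truncate (R : ℝ) : LipschitzWith 1 (truncate R) := by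
  have h : LipschitzWith 1 fun y : Fin 2 → ℝ => fun i => max (-R) (min R (y i)) :=
    LipschitzWith.of_dist_le_mul fun y y' => by
      rw [NNReal.coe_one, one_mul, dist_pi_le_iff dist_nonneg]
      intro i
      refine le_trans ?_ (dist_le_pi_dist y y' i)
      rw [Real.dist_eq, Real.dist_eq]
      refine (abs_max_sub_max_le_max _ _ _ _).trans ?_
      simpa using abs_min_sub_min_le_max R (y i) R (y' i)
  have h2 := (h.comp LipschitzWith.prod_fst).prodMk (h.comp LipschitzWith.prod_snd)
  rw [one_mul, max_self] at h2
  exact h2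

theorem truncate_mem {R R' : ℝ} (hR : 0 ≤ R) (hR' : R ≤ R') (x : (Fin 2 → ℝ) × (Fin 2 → ℝ)) :
    truncate R x ∈ Metric.closedBall (0 : (Fin 2 → ℝ) × (Fin 2 → ℝ)) R' := by
  rw [mem_closedBall_zero_iff, Prod.norm_def]
  have : ∀ y : Fin 2 → ℝ, ‖fun i => max (-R) (min R (y i))‖ ≤ R' := fun y =>
    (pi_norm_le_iff_of_nonneg (hR.trans hR')).2 fun i =>
      abs_le.2 ⟨(neg_le_neg hR').trans (le_max_left _ _),
        (max_le (by linarith) (min_le_left _ _)).trans hR'⟩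
  exact max_le (this _) (this _)

theorem truncate_eq_self {R : ℝ} {x : (Fin 2 → ℝ) × (Fin 2 → ℝ)} (h1 : ∀ i, |x.1 i| ≤ R)
    (h2 : ∀ i, |x.2 i| ≤ R) : truncate R x = x := by
  refine Prod.ext (funext fun i => ?_) (funext fun i => ?_)
  · exact (congrArg _ (min_eq_right (abs_le.1 (h1 i)).2)).trans
      (max_eq_right (abs_le.1 (h1 i)).1)
  · exact (congrArg _ (min_eq_right (abs_le.1 (h2 i)).2)).trans
      (max_eq_right (abs_le.1 (h2 i)).1)

theorem continuous_truncate (x : (Fin 2 → ℝ) × (Fin 2 → ℝ)) :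
    Continuous fun R => truncate R x := by
  unfold truncate
  fun_prop

/-! ### Global existence for the closed loop -/

/-- Cramer's rule for a symmetric `2 × 2` system. -/
theorem cramer_two {a b m : ℝ} (hd : a * b - m ^ 2 ≠ 0) (r s : ℝ) :
    a * ((b * r + m * s) / (a * b - m ^ 2)) - m * ((m * r + a * s) / (a * b - m ^ 2)) = r ∧
      -m * ((b * r + m * s) / (a * b - m ^ 2)) + b * ((m * r + a * s) / (a * b - m ^ 2)) = s := by
  constructor
  · rw [← mul_div_assoc, ← mul_div_assoc, ← sub_div, div_eq_iff hd]
    ring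
  · rw [← mul_div_assoc, ← mul_div_assoc, ← add_div, div_eq_iff hd]
    ring

/-- A `C¹` map composed with a bounded Lipschitz feedback `h ∘ f` is Lipschitz and bounded on balls,
uniformly over bounded inputs. -/
theorem exists_bounds_of_contDiff {E F : Type*} [NormedAddCommGroup E] [NormedSpace ℝ E]
    [ProperSpace E] [NormedAddCommGroup F] [NormedSpace ℝ F] {G : E × ℝ × ℝ → F} {f : E → ℝ}
    {h : ℝ → ℝ} {D : ℝ} {Kh : NNReal} (hG : ContDiff ℝ 1 G) (hf : ContDiff ℝ 1 f)
    (hh : LipschitzWith Kh h) (hD : ∀ y, |h y| ≤ D) (R W : ℝ) :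
    ∃ K L : NNReal, ∀ w, |w| ≤ W →
      LipschitzOnWith K (fun x => G (x, w, h (f x))) (Metric.closedBall 0 R) ∧
        ∀ x ∈ Metric.closedBall 0 R, ‖G (x, w, h (f x))‖ ≤ L := by
  obtain ⟨Kf, hKf⟩ := hf.locallyLipschitz.locallyLipschitzOn.exists_lipschitzOnWith_of_compact
    (isCompact_closedBall (0 : E) R)
  have hS : IsCompact (Metric.closedBall (0 : E) R ×ˢ Set.Icc (-W) W ×ˢ Set.Icc (-D) D) :=
    (isCompact_closedBall 0 R).prod (isCompact_Icc.prod isCompact_Icc)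
  obtain ⟨KG, hKG⟩ := hG.locallyLipschitz.locallyLipschitzOn.exists_lipschitzOnWith_of_compact hS
  obtain ⟨L, hL⟩ := hS.exists_bound_of_continuousOn hG.continuous.continuousOn
  have hmem : ∀ w, |w| ≤ W → ∀ x ∈ Metric.closedBall (0 : E) R, (x, w, h (f x)) ∈
      Metric.closedBall (0 : E) R ×ˢ Set.Icc (-W) W ×ˢ Set.Icc (-D) D :=
    fun w hw x hx => ⟨hx, abs_le.1 hw, abs_le.1 (hD _)⟩
  refine ⟨KG * max 1 (max 0 (Kh * Kf)), L.toNNReal, fun w hw => ⟨?_, fun x hx =>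
    (hL _ (hmem w hw x hx)).trans (Real.le_coe_toNNReal L)⟩⟩
  have hin : LipschitzOnWith (max 1 (max 0 (Kh * Kf))) (fun x : E => (x, w, h (f x)))
      (Metric.closedBall 0 R) :=
    LipschitzWith.id.lipschitzOnWith.prodMk
      ((LipschitzWith.const w).lipschitzOnWith.prodMk (hh.comp_lipschitzOnWith hKf))
  exact hKG.comp hin (hmem w hw)

theorem differentiableWithinAt_comp {E : Type*} [NormedAddCommGroup E] [NormedSpace ℝ E]
    {V : E → ℝ} (hV : ContDiff ℝ 1 V) {z : ℝ → E} {S : Set ℝ} {s : ℝ}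
    (hz : DifferentiableWithinAt ℝ z S s) : DifferentiableWithinAt ℝ (fun s => V (z s)) S s :=
  ((hV.differentiable one_ne_zero) (z s)).comp_differentiableWithinAt s hz

namespace Params

variable (p : Params)

/-- The acceleration as a function of the state, the attitude error `w` and the value `η` of the
factor `un cos θ_d`. It is smooth in all arguments; only `η` depends on the state in a merely
Lipschitz way. -/
def acc (qd : Fin 2 → ℝ) (x : (Fin 2 → ℝ) × (Fin 2 → ℝ)) (w η : ℝ) : Fin 2 → ℝ :=
  let m := p.Ma * p.L * Real.sin (x.1 1)
  let r0 := p.kpx * (qd 0 - x.1 0) - p.kvx * x.2 0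
    + p.Ma * p.L * Real.cos (x.1 1) * x.2 1 ^ 2
  let r1 := p.kpa * Real.cos w * (qd 1 - x.1 1) - p.kva * Real.cos w * x.2 1
    + (η * Real.sin w - 2 * (p.Ma * p.L * p.g * Real.cos (x.1 1)) * Real.sin (w / 2) ^ 2)
  let d := p.Mt * (p.I0 * p.L) - m ^ 2
  ![(p.I0 * p.L * r0 + m * r1) / d, (m * r0 + p.Mt * r1) / d]

theorem motion_acc (qd : Fin 2 → ℝ) (x : (Fin 2 → ℝ) × (Fin 2 → ℝ)) (w : ℝ) :
    let f := p.ft qd x.1 x.2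
    p.M x.1 *ᵥ p.acc qd x w (p.un f * Real.cos (p.thetaD f)) + p.C x.1 x.2 *ᵥ x.2 + p.grav x.1
      = p.tau qd x.1 x.2 w := by
  intro f
  have hd := (p.inertia_det_pos (x.1 1)).ne'
  rw [motion_iff]
  have e : p.delta qd x.1 x.2 w 1 = p.un f * Real.cos (p.thetaD f) * Real.sin w
    - 2 * (p.Ma * p.L * p.g * Real.cos (x.1 1)) * Real.sin (w / 2) ^ 2 := rfl
  rw [e]
  generalize p.un f * Real.cos (p.thetaD f) = η
  have hsol := cramer_two hd
    (p.kpx * (qd 0 - x.1 0) - p.kvx * x.2 0 + p.Ma * p.L * Real.cos (x.1 1) * x.2 1 ^ 2)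
    (p.kpa * Real.cos w * (qd 1 - x.1 1) - p.kva * Real.cos w * x.2 1
      + (η * Real.sin w - 2 * (p.Ma * p.L * p.g * Real.cos (x.1 1)) * Real.sin (w / 2) ^ 2))
  simp only [acc, cons_val_zero, cons_val_one]
  exact ⟨by linear_combination hsol.1, by linear_combination hsol.2⟩

theorem contDiff_acc (qd : Fin 2 → ℝ) :
    ContDiff ℝ 1 fun y : ((Fin 2 → ℝ) × (Fin 2 → ℝ)) × ℝ × ℝ => p.acc qd y.1 y.2.1 y.2.2 := by
  have hd : ∀ y : ((Fin 2 → ℝ) × (Fin 2 → ℝ)) × ℝ × ℝ,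
      p.Mt * (p.I0 * p.L) - (p.Ma * p.L * Real.sin (y.1.1 1)) ^ 2 ≠ 0 := fun y =>
    (p.inertia_det_pos (y.1.1 1)).ne'
  have h1 : ∀ i, ContDiff ℝ 1 fun y : ((Fin 2 → ℝ) × (Fin 2 → ℝ)) × ℝ × ℝ => y.1.1 i := fun i =>
    (contDiff_apply ℝ ℝ i).comp (contDiff_fst.comp contDiff_fst)
  have h2 : ∀ i, ContDiff ℝ 1 fun y : ((Fin 2 → ℝ) × (Fin 2 → ℝ)) × ℝ × ℝ => y.1.2 i := fun i =>
    (contDiff_apply ℝ ℝ i).comp (contDiff_snd.comp contDiff_fst)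
  rw [contDiff_pi, Fin.forall_fin_two]
  constructor
  · simp only [acc, cons_val_zero]
    refine ContDiff.div ?_ ?_ hd <;> fun_prop
  · simp only [acc, cons_val_one]
    refine ContDiff.div ?_ ?_ hd <;> fun_prop

/-- The closed loop as a first-order system in the state `(q, v)`. -/
def field (qd : Fin 2 → ℝ) (w : ℝ) (x : (Fin 2 → ℝ) × (Fin 2 → ℝ)) :
    (Fin 2 → ℝ) × (Fin 2 → ℝ) :=
  (x.2, p.acc qd x w (p.un (p.ft qd x.1 x.2) * Real.cos (p.thetaD (p.ft qd x.1 x.2))))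

theorem contDiff_ft (qd : Fin 2 → ℝ) :
    ContDiff ℝ 1 fun x : (Fin 2 → ℝ) × (Fin 2 → ℝ) => p.ft qd x.1 x.2 := by
  have h1 : ∀ i, ContDiff ℝ 1 fun x : (Fin 2 → ℝ) × (Fin 2 → ℝ) => x.1 i := fun i =>
    (contDiff_apply ℝ ℝ i).comp contDiff_fst
  have h2 : ∀ i, ContDiff ℝ 1 fun x : (Fin 2 → ℝ) × (Fin 2 → ℝ) => x.2 i := fun i =>
    (contDiff_apply ℝ ℝ i).comp contDiff_snd
  unfold ft
  fun_prop

theorem contDiff_lyap (k : ℝ) (qd : Fin 2 → ℝ) :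
    ContDiff ℝ 1 fun x : (Fin 2 → ℝ) × (Fin 2 → ℝ) => p.lyap k qd x.1 x.2 := by
  have h1 : ∀ i, ContDiff ℝ 1 fun x : (Fin 2 → ℝ) × (Fin 2 → ℝ) => x.1 i := fun i =>
    (contDiff_apply ℝ ℝ i).comp contDiff_fst
  have h2 : ∀ i, ContDiff ℝ 1 fun x : (Fin 2 → ℝ) × (Fin 2 → ℝ) => x.2 i := fun i =>
    (contDiff_apply ℝ ℝ i).comp contDiff_snd
  simp only [lyap, inertiaForm, Pi.sub_apply]
  fun_prop

/-- The closed loop is Lipschitz and bounded on balls, uniformly over bounded inputs. -/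
theorem exists_field_bounds (qd : Fin 2 → ℝ) (R W : ℝ) : ∃ K L : NNReal, ∀ w, |w| ≤ W →
    LipschitzOnWith K (p.field qd w) (Metric.closedBall 0 R) ∧
      ∀ x ∈ Metric.closedBall 0 R, ‖p.field qd w x‖ ≤ L := by
  obtain ⟨D, -, hD⟩ := p.exists_abs_un_mul_cos_le
  obtain ⟨K, hK⟩ := p.exists_lipschitzWith_un_mul_cos
  have hG : ContDiff ℝ 1 fun y : ((Fin 2 → ℝ) × (Fin 2 → ℝ)) × ℝ × ℝ =>
      (y.1.2, p.acc qd y.1 y.2.1 y.2.2) :=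
    (contDiff_snd.comp contDiff_fst).prodMk (p.contDiff_acc qd)
  have hbounds := exists_bounds_of_contDiff hG (p.contDiff_ft qd) hK hD R W
  exact hbounds

theorem continuous_field (qd : Fin 2 → ℝ) {w : ℝ → ℝ} (hw : Continuous w)
    {x : ℝ → (Fin 2 → ℝ) × (Fin 2 → ℝ)} (hx : Continuous x) :
    Continuous fun t => p.field qd (w t) (x t) := by
  obtain ⟨Kη, hη⟩ := p.exists_lipschitzWith_un_mul_cos
  have h1 : Continuous fun t => p.ft qd (x t).1 (x t).2 := (p.contDiff_ft qd).continuous.comp hx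
  exact (continuous_snd.comp hx).prodMk ((p.contDiff_acc qd).continuous.comp
    (hx.prodMk (hw.prodMk (hη.continuous.comp h1))))

/-- Under bounded inputs with `cos w ≥ 0` the energy grows at most exponentially. -/
theorem exists_energy_rate_le (W : ℝ) : ∃ k > 0, ∀ (qd q v : Fin 2 → ℝ) (w : ℝ), |w| ≤ W →
    0 ≤ Real.cos w → p.lyapRate 0 qd q v w ≤ k * (p.lyap 0 qd q v + 1) := by
  obtain ⟨D, hD, hδ⟩ := p.exists_abs_delta_le
  obtain ⟨c₁, hc₁, c₂, -, hV⟩ := p.exists_lyap_bounds (k := 0) (by simpa using p.kpa_pos)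
  have hkpa := p.kpa_pos
  have hkva := p.kva_pos
  have hkvx := p.kvx_pos
  refine ⟨(p.kpa + 1) / c₁ + (D * W) ^ 2, by positivity, fun qd q v w hw hcw => ?_⟩
  have h1 := (hV qd q v).1
  have hV0 : 0 ≤ p.lyap 0 qd q v := le_trans (by positivity) h1
  have hN : nrmPair (qd - q) v ^ 2 ≤ p.lyap 0 qd q v / c₁ := by
    rw [le_div_iff₀ hc₁]; linarith
  have e0 : (qd - q) 0 = qd 0 - q 0 := rfl
  have e1 : (qd - q) 1 = qd 1 - q 1 := rfl
  rw [nrmPair_sq, e0, e1] at hN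
  have hd : p.delta qd q v w 1 ^ 2 ≤ (D * W) ^ 2 := by
    rw [← sq_abs]
    refine pow_le_pow_left₀ (abs_nonneg _) ((hδ qd q v w).trans ?_) 2
    gcongr
  unfold lyapRate
  set d := p.delta qd q v w 1
  set x0 := qd 0 - q 0
  set x1 := qd 1 - q 1
  have y1 : 0 ≤ p.kvx * v 0 ^ 2 + p.kva * Real.cos w * v 1 ^ 2 := by positivity
  have hb : 0 ≤ p.kpa * (1 - Real.cos w) := mul_nonneg hkpa.le (by linarith [Real.cos_le_one w])
  have hb1 : p.kpa * (1 - Real.cos w) ≤ p.kpa := by nlinarith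
  have y2 : -(p.kpa * (1 - Real.cos w) * x1 * v 1) ≤ p.kpa * (x1 ^ 2 + v 1 ^ 2) := by
    have h2 : -(p.kpa * (1 - Real.cos w) * x1 * v 1)
        ≤ p.kpa * (1 - Real.cos w) * (x1 ^ 2 + v 1 ^ 2) := by
      linarith only [mul_nonneg hb (sq_nonneg (x1 + v 1)), mul_nonneg hb (sq_nonneg x1),
        mul_nonneg hb (sq_nonneg (v 1))]
    exact h2.trans (mul_le_mul_of_nonneg_right hb1 (by positivity))
  have y3 : v 1 * d ≤ v 1 ^ 2 + (D * W) ^ 2 := by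
    linarith only [hd, sq_nonneg (v 1 - d), sq_nonneg (v 1), sq_nonneg d]
  have y4 : p.kpa * (x1 ^ 2 + v 1 ^ 2) + v 1 ^ 2
      ≤ (p.kpa + 1) * (x0 ^ 2 + x1 ^ 2 + (v 0 ^ 2 + v 1 ^ 2)) := by
    have : 0 ≤ p.kpa * (x0 ^ 2 + v 0 ^ 2) := by positivity
    linarith only [this, sq_nonneg x0, sq_nonneg x1, sq_nonneg (v 0)]
  have y5 := mul_le_mul_of_nonneg_left hN (by positivity : 0 ≤ p.kpa + 1)
  have y6 : (p.kpa + 1) * (p.lyap 0 qd q v / c₁) = (p.kpa + 1) / c₁ * p.lyap 0 qd q v := by ring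
  have y7 : 0 ≤ (p.kpa + 1) / c₁ := by positivity
  have y8 : 0 ≤ (D * W) ^ 2 * p.lyap 0 qd q v := by positivity
  linarith

/-- Global existence. The right-hand side is truncated outside a ball whose radius grows as fast as
the a priori bound given by the energy, so that the truncation is never active. -/
theorem exists_isTraj (qd q₀ v₀ : Fin 2 → ℝ) {w : ℝ → ℝ} {W : ℝ} (hW : W ≤ Real.pi / 2)
    (hwc : ContinuousOn w (Set.Ici 0)) (hw : ∀ t, 0 ≤ t → |w t| < W) :
    ∃ q v : ℝ → Fin 2 → ℝ, p.IsTraj qd (Set.Ici 0) w q v ∧ q 0 = q₀ ∧ v 0 = v₀ := by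
  obtain ⟨k, hk, hrate⟩ := p.exists_energy_rate_le W
  obtain ⟨c₁, hc₁, c₂, -, hV⟩ := p.exists_lyap_bounds (k := 0) (by simpa using p.kpa_pos)
  have hV0 : ∀ q v, 0 ≤ p.lyap 0 qd q v := fun q v => le_trans (by positivity) (hV qd q v).1
  set w' : ℝ → ℝ := fun t => w (max t 0) with hw'
  have hw'c : Continuous w' :=
    hwc.comp_continuous (continuous_id.max continuous_const) fun t => Set.mem_Ici.2 (le_max_right _ _)
  have hw'b : ∀ t, |w' t| < W := fun t => hw _ (le_max_right _ _)
  have hw'e : ∀ t, 0 ≤ t → w' t = w t := fun t ht => by rw [hw']; simp [ht]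
  set V₀ := p.lyap 0 qd q₀ v₀
  have hV₀ : 0 ≤ V₀ := hV0 q₀ v₀
  -- `E` dominates the energy, and `R` the state as long as `E` dominates the energy
  set E : ℝ → ℝ := fun t => (V₀ + 1) * Real.exp ((k + 1) * t) - 1 with hE
  set R : ℝ → ℝ := fun t => ‖qd‖ + 1 + (V₀ + 1) * Real.exp ((k + 1) * t) / c₁ with hR
  have hR0 : ∀ t, 0 ≤ R t := fun t => by positivity
  have hRm : Monotone R := fun s t hst => by
    simp only [hR]
    gcongr
  have hRc : Continuous R := by fun_prop
  have hinR : ∀ t q v, p.lyap 0 qd q v ≤ E t → truncate (R t) (q, v) = (q, v) := by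
    intro t q v h
    have h1 : nrmPair (qd - q) v ^ 2 ≤ (V₀ + 1) * Real.exp ((k + 1) * t) / c₁ := by
      rw [le_div_iff₀ hc₁]
      linarith [(hV qd q v).1]
    have h2 : nrmPair (qd - q) v ≤ 1 + (V₀ + 1) * Real.exp ((k + 1) * t) / c₁ := by
      nlinarith [sq_nonneg (nrmPair (qd - q) v - 1)]
    obtain ⟨b0, b1, b2, b3⟩ := abs_coord_le_nrmPair (qd - q) v
    have hq : ∀ i, |(qd - q) i| ≤ nrmPair (qd - q) v → |q i| ≤ R t := by
      intro i hi
      have h3 : |qd i| ≤ ‖qd‖ := norm_le_pi_norm qd i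
      have h4 : |q i| ≤ |qd i| + |(qd - q) i| := by
        have : q i = qd i - (qd - q) i := by simp
        rw [this]
        exact abs_sub _ _
      simp only [hR]
      linarith
    have hv : ∀ i, |v i| ≤ nrmPair (qd - q) v → |v i| ≤ R t := by
      intro i hi
      simp only [hR]
      linarith [norm_nonneg qd]
    exact truncate_eq_self (Fin.forall_fin_two.2 ⟨hq 0 b0, hq 1 b1⟩)
      (Fin.forall_fin_two.2 ⟨hv 0 b2, hv 1 b3⟩)
  choose K L hKL using fun n : ℕ => p.exists_field_bounds qd (R n) W
  obtain ⟨z, hz0, hzc, hz⟩ := exists_global_solution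
    (F := fun t x => p.field qd (w' t) (truncate (R t) x)) (q₀, v₀)
    (fun n => ⟨K n * 1, fun t ht => lipschitzOnWith_univ.1
      (((hKL n (w' t) (hw'b t).le).1).comp (lipschitzWith_truncate (R t)).lipschitzOnWith
        fun x _ => truncate_mem (hR0 t) (hRm ht.2) x)⟩)
    (fun n => ⟨L n, fun t ht x =>
      (hKL n (w' t) (hw'b t).le).2 _ (truncate_mem (hR0 t) (hRm ht.2) x)⟩)
    (fun x => p.continuous_field qd hw'c ((continuous_truncate x).comp hRc))
  have hmotion : ∀ t, 0 ≤ t → p.lyap 0 qd (z t).1 (z t).2 ≤ E t →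
      HasDerivWithinAt (fun s => (z s).1) (z t).2 (Set.Ici t) t ∧
      ∃ a : Fin 2 → ℝ, HasDerivWithinAt (fun s => (z s).2) a (Set.Ici t) t ∧
        p.M (z t).1 *ᵥ a + p.C (z t).1 (z t).2 *ᵥ (z t).2 + p.grav (z t).1
          = p.tau qd (z t).1 (z t).2 (w' t) := by
    intro t ht h
    have h1 := hz t ht
    rw [hinR t (z t).1 (z t).2 h] at h1
    exact ⟨h1.fst, _, h1.snd, p.motion_acc qd (z t) (w' t)⟩
  have henergy : ∀ t, 0 ≤ t → p.lyap 0 qd (z t).1 (z t).2 ≤ E t := by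
    intro t ht
    have hEd : ∀ s, HasDerivAt E ((k + 1) * (E s + 1)) s := by
      intro s
      have h1 := ((((hasDerivAt_id s).const_mul (k + 1)).exp).const_mul (V₀ + 1)).sub_const 1
      refine h1.congr_deriv ?_
      simp only [hE, id]
      ring
    have hdiff : ∀ s ∈ Set.Ico 0 t, HasDerivWithinAt (fun s => p.lyap 0 qd (z s).1 (z s).2)
        (derivWithin (fun s => p.lyap 0 qd (z s).1 (z s).2) (Set.Ici s) s) (Set.Ici s) s := by
      intro s hs
      have h1 : DifferentiableWithinAt ℝ z (Set.Ici s) s := (hz s hs.1).differentiableWithinAt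
      have h2 := differentiableWithinAt_comp (p.contDiff_lyap 0 qd) h1
      exact h2.hasDerivWithinAt
    have hcont : ContinuousOn (fun s => p.lyap 0 qd (z s).1 (z s).2) (Set.Icc 0 t) :=
      p.continuousOn_lyap 0 (continuous_fst.comp_continuousOn (hzc.mono fun s hs => hs.1))
        (continuous_snd.comp_continuousOn (hzc.mono fun s hs => hs.1))
    have hinit : p.lyap 0 qd (z 0).1 (z 0).2 ≤ E 0 := by simp [hz0, hE, V₀]
    have hstep : ∀ s ∈ Set.Ico 0 t, p.lyap 0 qd (z s).1 (z s).2 = E s →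
        derivWithin (fun s => p.lyap 0 qd (z s).1 (z s).2) (Set.Ici s) s
          < (k + 1) * (E s + 1) := by
      intro s hs heq
      obtain ⟨hq, a, hv, hm⟩ := hmotion s hs.1 heq.le
      have h1 := p.hasDerivWithinAt_lyap (q := fun s => (z s).1) (v := fun s => (z s).2) 0 hq hv hm
      rw [h1.derivWithin (uniqueDiffOn_Ici s s Set.self_mem_Ici)]
      have hcos : 0 ≤ Real.cos (w' s) := by
        have := abs_lt.1 (hw'b s)
        exact Real.cos_nonneg_of_mem_Icc ⟨by linarith, by linarith⟩
      have h2 := hrate qd (z s).1 (z s).2 (w' s) (hw'b s).le hcos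
      have h3 := hV0 (z s).1 (z s).2
      rw [← heq]
      linarith
    have key := image_le_of_deriv_right_lt_deriv_boundary hcont hdiff hinit hEd hstep
    exact key ⟨ht, le_rfl⟩
  refine ⟨fun t => (z t).1, fun t => (z t).2, ⟨continuous_fst.comp_continuousOn hzc,
    continuous_snd.comp_continuousOn hzc, fun t ht => ?_⟩, by simp [hz0], by simp [hz0]⟩
  have h := hmotion t ht (henergy t ht)
  rw [hw'e t ht] at h
  exact h

end Params

end AerialManip

end

theorem lemma4 (p : AerialManip.Params) :
    (∃ c : AerialManip.Consts, AerialManip.Admissible p c) ∧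
    ∀ c : AerialManip.Consts, AerialManip.Admissible p c →
      0 < AerialManip.qMax c ∧ 0 < AerialManip.thetaMax p c ∧
      (∀ xd ad : ℝ, ad ∈ Set.Ioo p.alphaMin p.alphaMax →
        AerialManip.ISSWithRestriction p ![xd, ad] (AerialManip.thetaMax p c)
          (AerialManip.qMax c)) ∧
      ∃ Gout : ℝ, 0 ≤ Gout ∧ ∀ xd ad : ℝ, ad ∈ Set.Ioo p.alphaMin p.alphaMax →
        AerialManip.HasAsymptoticGain p ![xd, ad] (AerialManip.thetaMax p c)
          (AerialManip.qMax c) Gout := by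
  refine ⟨AerialManip.exists_admissible p, fun c h => ⟨h.qMax_pos, h.thetaMax_pos,
    fun xd ad _ => ⟨fun q₀ v₀ w hwc hw => ?_, h.exists_iss_estimate _, h.exists_small_nrm_lt _⟩, ?_⟩⟩
  · have hW : AerialManip.thetaMax p c ≤ Real.pi / 2 :=
      (min_le_right _ _).trans (by linarith [h.xi_pos])
    exact p.exists_isTraj _ q₀ v₀ hW hwc hw
  · obtain ⟨G, hG, hgain⟩ := h.exists_asymptoticGain
    exact ⟨G, hG, fun xd ad _ => hgain _⟩
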